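/- **Conventions.** For a finite set $\tau$ of relation symbols, a $\tau$-structure $A$ has a non-empty finite universe $V(A)$ and is equipped with a number sort $N(A)=\{0,1,\dots,|V(A)|\}$. Structure variables range over $V(A)$ and number variables over $N(A)$; for a tuple $\bar u$ of variables, $A^{\bar u}$ is the product of the ranges of its entries. Two tuples are compatible if they have the same length and the same sorts. For $\bar n=(n_1,\dots,n_k)\in N(A)^k$ let $\langle\bar n\rangle=\sum_{i=1}^k n_i(|V(A)|+1)^{i-1}$. *First-order logic with counting* extends first-order logic over these two sorts by the formulae $p\le q$ for number variables $p,q$, and $\#\bar u\,\psi=\bar p$ for tuples $\bar u$ of distinct variables, tuples $\bar p$ of number variables and formulae $\psi$; the latter holds in $(A,\alpha)$ iff $|\{\bar a\in A^{\bar u}: (A,\alpha[\bar a/\bar u])\models\psi\}|=\langle\alpha(\bar p)\rangle$. The logic $\mathrm{LREC}[\tau]$ has, in addition, for compatible tuples $\bar u,\bar v,\bar w$ of variables, non-empty tuples $\bar p,\bar r$ of number variables (where the variables in $\bar u,\bar v$ are pairwise distinct, and so are those in $\bar p$), and formulae $\varphi_E,\varphi_C$, the formula $\varphi=[\mathrm{lrec}_{\bar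 u,\bar v,\bar p}\;\varphi_E,\varphi_C](\bar w,\bar r)$. Its free variables are those of $\varphi_E$ not in $\bar u,\bar v$, those of $\varphi_C$ not in $\bar u,\bar p$, and those in $\bar w,\bar r$. For a structure $A$ and an assignment $\alpha$, put $E=\{(\bar a,\bar b)\in A^{\bar u}\times A^{\bar u}:(A,\alpha[\bar a/\bar u,\bar b/\bar v])\models\varphi_E\}$ and $C(\bar a)=\{\langle\bar n\rangle: (A,\alpha[\bar a/\bar u][\bar n/\bar p])\models\varphi_C\}$. Define $X\subseteq A^{\bar u}\times\mathbb N$ by recursion on $\ell$: $$(\bar a,\ell)\in X\iff \ell>0\ \text{ and }\ \Bigl|\Bigl\{\bar b:(\bar a,\bar b)\in E,\ \Bigl(\bar b,\Bigl\lfloor\tfrac{\ell-1}{|\{\bar a':(\bar a',\bar b)\in E\}|}\Bigr\rfloor\Bigr)\in X\Bigr\}\Bigr|\in C(\bar a).$$ Then $(A,\alpha)\models\varphi$ iff $(\alpha(\bar w),\langle\alpha(\bar r)\rangle)\in X$. A *directed tree* is a finite directed graph $T$, viewed as a structure over the vocabulary $\{E\}$ with $E$ binary, whose edges are directed away from a root: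 the root has no in-neighbour, every vertex is reachable from it, and every vertex has at most one in-neighbour. For $v\in V(T)$, $T_v$ is the subtree of $T$ rooted at $v$, that is, the subgraph induced on all vertices reachable from $v$ (including $v$). **Statement.** There is a single $\mathrm{LREC}[\{E\}]$-formula $\varphi_{\cong}(x,y)$, whose free variables are among the structure variables $x,y$, such that for every directed tree $T$ and all $v,w\in V(T)$, $$T\models\varphi_{\cong}[v,w]\iff T_v\cong T_w .$$ -/

import Mathlib

/-! First-order logic with counting, its extension `LREC` by a limited recursion operator,
directed trees, and their rooted subtrees. -/

namespace LREC

universe u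

/-- The two sorts: elements of the universe of a structure, and numbers. -/
inductive Srt : Type
  | elt
  | num

/-- A variable is a sort together with a name. -/
structure Var : Type where
  sort : Srt
  name : ℕ

/-- The range of the variables of a given sort in a structure with universe `V`:
the universe itself for structure variables, and the numbers `0, …, |V|` for number variables. -/
def Dom (V : Type u) : Srt → Type u
  | .elt => V
  | .num => ULift.{u} (Fin (Nat.card V + 1))

/-- The natural number denoted by an element of the number sort. -/
def numVal {V : Type u} (a : Dom V .num) : ℕ := (ULift.down a : Fin (Nat.card V + 1)).val

/-- The number `∑ nᵢ (|V| + 1)ⁱ⁻¹` (with `i` counted from `1`) coded by a tuple of numbers. -/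
noncomputable def tupleVal {V : Type u} {k : ℕ} (n : Fin k → Dom V .num) : ℕ :=
  ∑ i : Fin k, numVal (n i) * (Nat.card V + 1) ^ (i : ℕ)

/-- The set of values of a tuple of variables with the sorts `s`. -/
abbrev TupleDom (V : Type u) {k : ℕ} (s : Fin k → Srt) : Type u := ∀ i, Dom V (s i)

/-- The tuple of variables with sorts `s` and names `x`.
Two tuples of variables are compatible exactly if they have the same sorts `s`. -/
def vars {k : ℕ} (s : Fin k → Srt) (x : Fin k → ℕ) : Fin k → Var := fun i => ⟨s i, x i⟩

/-- The tuple of number variables with names `p`. -/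
def numVars {k : ℕ} (p : Fin k → ℕ) : Fin k → Var := vars (fun _ => .num) p

/-- An assignment in a structure with universe `V`. -/
abbrev Assignment (V : Type u) : Type u := ∀ x : Var, Dom V x.sort

/-- The value of a tuple of variables under an assignment. -/
def Assignment.tuple {V : Type u} (α : Assignment V) {k : ℕ} (s : Fin k → Srt) (x : Fin k → ℕ) :
    TupleDom V s :=
  fun i => α ⟨s i, x i⟩

open Classical in
/-- The assignment that sends the `i`-th variable of the tuple with sorts `s` and names `x` to
`a i`, and agrees with `α` on all other variables. It is used for tuples of distinct variables. -/
noncomputable def Assignment.update {V : Type u} (α : Assignment V) {k : ℕ} (s : Fin k → Srt)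
    (x : Fin k → ℕ) (a : TupleDom V s) : Assignment V :=
  fun y => if h : ∃ i, vars s x i = y then h.choose_spec ▸ a h.choose else α y

theorem Assignment.update_of_mem {V : Type u} (α : Assignment V) {k : ℕ} (s : Fin k → Srt)
    (x : Fin k → ℕ) (hx : Function.Injective (vars s x)) (a : TupleDom V s) (i : Fin k) :
    α.update s x a ⟨s i, x i⟩ = a i := by
  have h : ∃ j, vars s x j = ⟨s i, x i⟩ := ⟨i, rfl⟩
  have key : ∀ (j : Fin k) (hj : vars s x j = ⟨s i, x i⟩),
      (hj ▸ a j : Dom V (Var.sort ⟨s i, x i⟩)) = a i := by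
    intro j hj
    obtain rfl : j = i := hx hj
    rfl
  unfold Assignment.update
  rw [dif_pos h]
  exact key _ _

theorem Assignment.update_of_notMem {V : Type u} (α : Assignment V) {k : ℕ} (s : Fin k → Srt)
    (x : Fin k → ℕ) (a : TupleDom V s) (y : Var) (hy : ∀ i, vars s x i ≠ y) :
    α.update s x a y = α y := by
  unfold Assignment.update
  rw [dif_neg]
  rintro ⟨i, hi⟩
  exact hy i hi

/-- The formulae of `LREC` over a vocabulary given by the relation symbols of `L`.
All but the last constructor are those of first-order logic with counting; the remaining
connectives and the universal quantifier are abbreviations, as usual. -/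
inductive Formula (L : FirstOrder.Language.{0, 0}) : Type
  /-- `R(x₁, …, xₙ)` for structure variables `xᵢ` -/
  | rel {n : ℕ} (R : L.Relations n) (x : Fin n → ℕ)
  /-- `x = y` for two variables of the same sort -/
  | eq (s : Srt) (x y : ℕ)
  /-- `p ≤ q` for number variables -/
  | le (p q : ℕ)
  | not (φ : Formula L)
  | and (φ ψ : Formula L)
  /-- `∃ x φ` for a variable of either sort -/
  | ex (x : Var) (φ : Formula L)
  /-- `#u ψ = p` for a tuple `u` of distinct variables and a tuple `p` of number variables -/
  | count {k : ℕ} (s : Fin k → Srt) (u : Fin k → ℕ) (hu : Function.Injective (vars s u))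
      (ψ : Formula L) {m : ℕ} (p : Fin m → ℕ)
  /-- `[lrec_{u,v,p} φE, φC](w, r)` for compatible tuples `u, v, w` and non-empty tuples `p, r` of
  number variables; the variables in `u, v` are distinct, and so are those in `p` -/
  | lrec {k : ℕ} (s : Fin k → Srt) (u v : Fin k → ℕ) (hu : Function.Injective (vars s u))
      (hv : Function.Injective (vars s v)) (huv : ∀ i j, vars s u i ≠ vars s v j)
      {m : ℕ} (p : Fin (m + 1) → ℕ) (hp : Function.Injective (numVars p))
      (φE φC : Formula L) (w : Fin k → ℕ) {m' : ℕ} (r : Fin (m' + 1) → ℕ)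

/-- The free variables of a formula. -/
def Formula.free {L : FirstOrder.Language.{0, 0}} : Formula L → Set Var
  | .rel _ x => Set.range (vars (fun _ => .elt) x)
  | .eq s x y => {⟨s, x⟩, ⟨s, y⟩}
  | .le p q => {⟨.num, p⟩, ⟨.num, q⟩}
  | .not φ => φ.free
  | .and φ ψ => φ.free ∪ ψ.free
  | .ex x φ => φ.free \ {x}
  | .count s u _ ψ p => (ψ.free \ Set.range (vars s u)) ∪ Set.range (numVars p)
  | .lrec s u v _ _ _ p _ φE φC w r =>
      (φE.free \ (Set.range (vars s u) ∪ Set.range (vars s v))) ∪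
      (φC.free \ (Set.range (vars s u) ∪ Set.range (numVars p))) ∪
      Set.range (vars s w) ∪ Set.range (numVars r)

/-- The relation `X` that is defined by limited recursion from the edge relation `E` of a directed
graph and the labelling `C` of its vertices by sets of numbers, see `recRel_iff`. -/
def recRel {A : Type u} (E : A → A → Prop) (C : A → Set ℕ) (a : A) (l : ℕ) : Prop :=
  match l with
  | 0 => False
  | l + 1 => {b | E a b ∧ recRel E C b (l / {a' | E a' b}.ncard)}.ncard ∈ C a
termination_by l
decreasing_by exact Nat.lt_succ_of_le (Nat.div_le_self _ _)

theorem recRel_iff {A : Type u} (E : A → A → Prop) (C : A → Set ℕ) (a : A) (l : ℕ) :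
    recRel E C a l ↔
      0 < l ∧ {b | E a b ∧ recRel E C b ((l - 1) / {a' | E a' b}.ncard)}.ncard ∈ C a := by
  cases l with
  | zero => simp [recRel]
  | succ l => rw [recRel]; simp

/-- `α.Sat φ`: the formula `φ` holds in the structure `V` under the assignment `α`.
The structures of interest are finite. -/
def Assignment.Sat {L : FirstOrder.Language.{0, 0}} {V : Type u} [L.Structure V] :
    Assignment V → Formula L → Prop
  | α, .rel R x => FirstOrder.Language.Structure.RelMap R
      (fun i => (α ⟨.elt, x i⟩ : V))
  | α, .eq s x y => α ⟨s, x⟩ = α ⟨s, y⟩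
  | α, .le p q => numVal (α ⟨.num, p⟩) ≤ numVal (α ⟨.num, q⟩)
  | α, .not φ => ¬ Assignment.Sat α φ
  | α, .and φ ψ => Assignment.Sat α φ ∧ Assignment.Sat α ψ
  | α, .ex x φ => ∃ a : Dom V x.sort,
      Assignment.Sat (α.update (fun _ : Fin 1 => x.sort) (fun _ => x.name) (fun _ => a)) φ
  | α, .count s u _ ψ p =>
      {a : TupleDom V s | Assignment.Sat (α.update s u a) ψ}.ncard =
        tupleVal (α.tuple (fun _ => .num) p)
  | α, .lrec s u v _ _ _ p _ φE φC w r =>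
      recRel
        (fun a b : TupleDom V s => Assignment.Sat ((α.update s u a).update s v b) φE)
        (fun a : TupleDom V s => {N : ℕ | ∃ n : TupleDom V (fun _ => Srt.num),
          Assignment.Sat ((α.update s u a).update (fun _ => .num) p n) φC ∧ tupleVal n = N})
        (α.tuple s w) (tupleVal (α.tuple (fun _ => .num) r))

/-- The vocabulary `{E}` with one binary relation symbol. Its structures are the directed graphs. -/
abbrev digraphVocabulary : FirstOrder.Language.{0, 0} := FirstOrder.Language.graph

/-- The edge relation of a directed graph. -/
def Edge (V : Type u) [digraphVocabulary.Structure V] (a b : V) : Prop :=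
  FirstOrder.Language.Structure.RelMap FirstOrder.Language.adj ![a, b]

/-- A finite directed graph is a directed tree (with all edges directed away from the root) if it
has a vertex without in-neighbours, the root, such that every vertex can be reached from the root,
and every vertex has at most one in-neighbour. -/
def IsDirectedTree (V : Type u) [digraphVocabulary.Structure V] : Prop :=
  Finite V ∧ ∃ root : V, (∀ a, ¬ Edge V a root) ∧
    (∀ a, Relation.ReflTransGen (Edge V) root a) ∧
    ∀ a b c, Edge V a c → Edge V b c → a = b

/-- The edge relation of the subtree rooted at `v`, which is induced on the set of all vertices
that can be reached from `v`. -/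
abbrev SubtreeEdge {V : Type u} [digraphVocabulary.Structure V] (v : V) :
    {a : V // Relation.ReflTransGen (Edge V) v a} →
      {a : V // Relation.ReflTransGen (Edge V) v a} → Prop :=
  fun a b => Edge V a.1 b.1

/-- The subtrees rooted at `v` and `w` are isomorphic. -/
def SubtreeIso {V : Type u} [digraphVocabulary.Structure V] (v w : V) : Prop :=
  Nonempty (SubtreeEdge v ≃r SubtreeEdge w)

/-- The structure variable `x`. -/
def varX : Var := ⟨.elt, 0⟩

/-- The structure variable `y`. -/
def varY : Var := ⟨.elt, 1⟩

/-- `V ⊨ φ[v, w]` for a formula `φ(x, y)`: the formula holds under the assignments that send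
`x` to `v` and `y` to `w`. -/
def Models {L : FirstOrder.Language.{0, 0}} (V : Type u) [L.Structure V] (φ : Formula L)
    (v w : V) : Prop :=
  ∀ α : Assignment V, α varX = v → α varY = w → α.Sat φ

end LREC

/-! Two rooted subtrees are isomorphic iff their roots v, w have equally many children and each
isomorphism type among the children of v occurs equally often among those of w. Limited recursion
can evaluate this criterion, but it divides the resource by the in-degree of every node it enters,
so the recursion graph must reuse nodes sparingly compared with the drop in subtree size.

Nodes are pairs of vertices with a kind. `iso (v, w)` asks that every child a of v pass `child (a,
w)`, which seeks a child b of w with the same size and number of twins that passes `pair (a, b)`;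
this demands both `iso (a, b)` and `balance (a, b)`. Balance must compare two multiplicities
although a label tests only one count. It counts the twins of a isomorphic to b together with the
twins of b not isomorphic to a: for isomorphic a, b the total is `mult b` exactly when both have
equally many twins of their type (`ncard_twin_iso_add_eq_iff`). Negation is supplied by `nonIso`.

Write m = `mult a` = `mult b` and s = `size a`. The node `iso (a, b)` has in-degree at most m + 2,
the relevant `nonIso` nodes have in-degree m, and the other nodes entered have in-degree 1. Hence
the costliest descent to the next `iso` node loses a factor of about m(m + 2) < (m + 1)². Since v
has m + 1 disjoint subtrees of size s below it, `size v` ≥ (m + 1)s + 1, and a resource of `size v`²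
leaves at least s² (`mult_mul_size_lt`, `nodeRel_iso_iff`).

Sizes and twins are definable from reachability, itself a limited recursion with in-degree one on a
tree. Finally `recRel_map` transfers the recursion to the tuples that code nodes. -/

namespace LREC

universe u

/-! ### Directed trees: subtrees, twins and sizes -/

section Tree

variable {V : Type u} [digraphVocabulary.Structure V]

/-- `Reach v x`: the vertex `x` belongs to the subtree rooted at `v`. -/
abbrev Reach (v x : V) : Prop := Relation.ReflTransGen (Edge V) v x

/-- The number of vertices of the subtree rooted at `v`. -/
noncomputable def size (v : V) : ℕ := {x | Reach v x}.ncard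

/-- Distinct siblings whose subtrees have the same size. -/
def Twin (a b : V) : Prop := a ≠ b ∧ (∃ v, Edge V v a ∧ Edge V v b) ∧ size a = size b

/-- The number of twins of a vertex. -/
noncomputable def mult (a : V) : ℕ := {b | Twin a b}.ncard

theorem Twin.symm {a b : V} (h : Twin a b) : Twin b a := by
  obtain ⟨h1, ⟨v, h2, h3⟩, h4⟩ := h
  exact ⟨h1.symm, ⟨v, h3, h2⟩, h4.symm⟩

theorem Twin.size_eq {a b : V} (h : Twin a b) : size a = size b := h.2.2

namespace IsDirectedTree

theorem parent_unique (hT : IsDirectedTree V) {a b c : V} (h₁ : Edge V a c) (h₂ : Edge V b c) :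
    a = b := by
  obtain ⟨_, _, _, _, h⟩ := hT
  exact h a b c h₁ h₂

/-- As in-neighbours are unique, a cycle through a vertex also passes through its parent, and so
would reach the root, which has no in-neighbour. -/
theorem not_transGen_self (hT : IsDirectedTree V) (a : V) :
    ¬ Relation.TransGen (Edge V) a a := by
  obtain ⟨root, h0, hr, -⟩ := hT.2
  induction hr a with
  | refl =>
    intro h
    obtain ⟨c, -, hc⟩ := Relation.TransGen.tail'_iff.1 h
    exact h0 _ hc
  | tail _ hxy ih =>
    intro h
    obtain ⟨c, hc, hcy⟩ := Relation.TransGen.tail'_iff.1 h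
    obtain rfl := hT.parent_unique hcy hxy
    exact ih (Relation.TransGen.head' hxy hc)

theorem not_reach_of_edge (hT : IsDirectedTree V) {a b : V} (h : Edge V a b) : ¬ Reach b a :=
  fun h' => hT.not_transGen_self a (Relation.TransGen.head' h h')

theorem ne_of_edge (hT : IsDirectedTree V) {a b : V} (h : Edge V a b) : a ≠ b := by
  rintro rfl
  exact hT.not_reach_of_edge h .refl

/-- The ancestors of x form a chain, and a vertex never lies strictly below its sibling. Thus
subtrees at distinct siblings are disjoint. -/
theorem child_unique (hT : IsDirectedTree V) {v a b x : V} (ha : Edge V v a) (hb : Edge V v b)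
    (hax : Reach a x) (hbx : Reach b x) : a = b := by
  have key : ∀ {a b : V}, Edge V v a → Edge V v b → Reach a b → a = b := by
    intro a b ha hb h
    rcases Relation.ReflTransGen.cases_tail h with h | ⟨c, hc, hcb⟩
    · exact h.symm
    · obtain rfl := hT.parent_unique hcb hb
      exact (hT.not_reach_of_edge ha hc).elim
  have U : Relator.RightUnique (Function.swap (Edge V)) := fun _ _ _ h₁ h₂ =>
    hT.parent_unique h₁ h₂
  rcases Relation.ReflTransGen.total_of_right_unique U hax.swap hbx.swap with h | h
  · exact (key hb ha (by simpa using h.swap)).symm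
  · exact key ha hb (by simpa using h.swap)

theorem twin_iff (hT : IsDirectedTree V) {v a b : V} (ha : Edge V v a) :
    Twin a b ↔ a ≠ b ∧ Edge V v b ∧ size a = size b := by
  constructor
  · rintro ⟨h1, ⟨w, h2, h3⟩, h4⟩
    obtain rfl := hT.parent_unique ha h2
    exact ⟨h1, h3, h4⟩
  · rintro ⟨h1, h2, h3⟩
    exact ⟨h1, ⟨v, ha, h2⟩, h3⟩

/-- A vertex together with its twins is the class of all siblings of that size, which twins share.
-/
theorem mult_eq_of_twin (hT : IsDirectedTree V) {a b : V} (h : Twin a b) : mult a = mult b := by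
  have := hT.1
  obtain ⟨h1, ⟨v, h2, h3⟩, h4⟩ := h
  have e : insert a {x | Twin a x} = insert b {x | Twin b x} := by
    ext x
    simp only [Set.mem_insert_iff, Set.mem_ofPred_eq, hT.twin_iff h2, hT.twin_iff h3]
    grind
  have := congrArg Set.ncard e
  rw [Set.ncard_insert_of_notMem (fun h => h.1 rfl), Set.ncard_insert_of_notMem (fun h => h.1 rfl)]
    at this
  exact Nat.succ_injective this

theorem mult_pos_of_twin (hT : IsDirectedTree V) {a b : V} (h : Twin a b) : 0 < mult a := by
  have := hT.1
  exact (Set.ncard_pos (Set.toFinite _)).2 ⟨b, h⟩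

theorem size_pos (hT : IsDirectedTree V) (v : V) : 0 < size v := by
  have := hT.1
  exact (Set.ncard_pos (Set.toFinite _)).2 ⟨v, .refl⟩

/-- The subtrees at a and its twins are disjoint, equally large and miss v. This inequality pays for
the recursion. -/
theorem mult_mul_size_lt (hT : IsDirectedTree V) {v a : V} (h : Edge V v a) :
    (mult a + 1) * size a + 1 ≤ size v := by
  classical
  have := hT.1
  have := Fintype.ofFinite V
  set S : Finset V := {b | Edge V v b ∧ size a = size b} with hS
  have hcard : S.card = mult a + 1 := by
    rw [mult, ← Set.ncard_insert_of_notMem (a := a) (fun h => h.1 rfl), ← Set.ncard_coe_finset]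
    congr 1
    ext x
    simp only [hS, Finset.coe_filter, Finset.mem_univ, true_and, Set.mem_ofPred_eq,
      Set.mem_insert_iff, hT.twin_iff h]
    grind
  let D : V → Finset V := fun b => {x | Reach b x}
  have hD : ∀ b, (D b).card = size b := fun b => by
    rw [size, ← Set.ncard_coe_finset]; simp [D]
  have hbi : (S.biUnion D).card = (mult a + 1) * size a := by
    rw [Finset.card_biUnion, ← hcard, Finset.sum_const_nat]
    · intro b hb
      rw [hD]
      exact ((Finset.mem_filter.1 hb).2.2).symm
    · intro b hb c hc hbc
      rw [Function.onFun, Finset.disjoint_left]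
      intro x hx hx'
      simp only [D, Finset.mem_filter, Finset.mem_univ, true_and] at hx hx'
      exact hbc (hT.child_unique (Finset.mem_filter.1 hb).2.1 (Finset.mem_filter.1 hc).2.1 hx hx')
  rw [← hbi, ← Finset.card_insert_of_notMem (a := v), ← hD v]
  · apply Finset.card_le_card
    intro x
    simp only [Finset.mem_insert, Finset.mem_biUnion, D, S, Finset.mem_filter, Finset.mem_univ,
      true_and]
    rintro (rfl | ⟨b, hb, hx⟩)
    · exact .refl
    · exact .head hb.1 hx
  · simp only [Finset.mem_biUnion, D, S, Finset.mem_filter, Finset.mem_univ, true_and]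
    rintro ⟨b, hb, hx⟩
    exact hT.not_reach_of_edge hb.1 hx

end IsDirectedTree

/-! ### Isomorphism of subtrees in terms of the children -/

theorem SubtreeIso.refl (v : V) : SubtreeIso v v := ⟨RelIso.refl _⟩

theorem SubtreeIso.symm {v w : V} (h : SubtreeIso v w) : SubtreeIso w v := h.map RelIso.symm

theorem SubtreeIso.trans {u v w : V} (h₁ : SubtreeIso u v) (h₂ : SubtreeIso v w) :
    SubtreeIso u w := by
  obtain ⟨e₁⟩ := h₁
  obtain ⟨e₂⟩ := h₂
  exact ⟨e₁.trans e₂⟩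

theorem SubtreeIso.size_eq {v w : V} (h : SubtreeIso v w) : size v = size w := by
  obtain ⟨e⟩ := h
  exact Nat.card_congr e.toEquiv

/-- Isomorphism of rooted subtrees as an equivalence relation. -/
def subtreeSetoid (V : Type u) [digraphVocabulary.Structure V] : Setoid V where
  r := SubtreeIso
  iseqv := ⟨SubtreeIso.refl, SubtreeIso.symm, SubtreeIso.trans⟩

theorem reach_subtreeEdge {v : V} {a b : {x // Reach v x}} :
    Relation.ReflTransGen (SubtreeEdge v) a b ↔ Reach a.1 b.1 := by
  constructor
  · intro h
    exact h.lift Subtype.val fun _ _ h => h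
  · intro h
    obtain ⟨a, ha⟩ := a
    obtain ⟨b, hb⟩ := b
    change Reach a b at h
    induction h with
    | refl => exact .refl
    | tail h h' ih => exact (ih (ha.trans h)).tail h'

/-- The root of the subtree at `v`. -/
abbrev subtreeRoot (v : V) : {x // Reach v x} := ⟨v, .refl⟩

/-- This describes the root by the edge relation alone, so that isomorphisms must preserve it. -/
theorem IsDirectedTree.eq_subtreeRoot_iff (hT : IsDirectedTree V) {v : V} (x : {x // Reach v x}) :
    x = subtreeRoot v ↔ ∀ y, ¬ SubtreeEdge v y x := by
  constructor
  · rintro rfl y h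
    exact hT.not_reach_of_edge h y.2
  · obtain ⟨x, hx⟩ := x
    intro h
    rcases Relation.ReflTransGen.cases_tail hx with rfl | ⟨c, hc, hcx⟩
    · rfl
    · exact (h ⟨c, hc⟩ hcx).elim

theorem IsDirectedTree.map_subtreeRoot (hT : IsDirectedTree V) {v w : V}
    (e : SubtreeEdge v ≃r SubtreeEdge w) : e (subtreeRoot v) = subtreeRoot w := by
  rw [hT.eq_subtreeRoot_iff]
  intro y hy
  obtain ⟨y, rfl⟩ := e.surjective y
  exact (hT.eq_subtreeRoot_iff _).1 rfl y (e.map_rel_iff.1 hy)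

/-- An isomorphism maps root to root, hence children to children; since it also preserves
reachability, it restricts to the subtrees at corresponding children. -/
theorem IsDirectedTree.exists_children_equiv (hT : IsDirectedTree V) {v w : V}
    (h : SubtreeIso v w) :
    ∃ e : {a // Edge V v a} ≃ {b // Edge V w b}, ∀ a, SubtreeIso a.1 (e a).1 := by
  obtain ⟨g⟩ := h
  have hg := hT.map_subtreeRoot g
  have hg' := hT.map_subtreeRoot g.symm
  have key : ∀ {v w : V} (g : SubtreeEdge v ≃r SubtreeEdge w),
      g (subtreeRoot v) = subtreeRoot w → ∀ a : {a // Edge V v a},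
      Edge V w (g ⟨a.1, .single a.2⟩).1 := by
    intro v w g hg a
    have h : SubtreeEdge v (subtreeRoot v) ⟨a.1, .single a.2⟩ := a.2
    have h' := g.map_rel_iff.2 h
    rwa [hg] at h'
  refine ⟨⟨fun a => ⟨_, key g hg a⟩, fun b => ⟨_, key g.symm hg' b⟩, fun a => ?_, fun b => ?_⟩,
    fun a => ?_⟩
  · simp
  · simp
  · have ha : Reach v a.1 := .single a.2
    have hr : ∀ x, Reach v x → ∀ hx : Reach v x,
        (Reach a.1 x ↔ Reach (g ⟨a.1, ha⟩).1 (g ⟨x, hx⟩).1) := by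
      intro x _ hx
      rw [← reach_subtreeEdge (a := g ⟨a.1, ha⟩) (b := g ⟨x, hx⟩),
        ← reach_subtreeEdge (a := ⟨a.1, ha⟩) (b := ⟨x, hx⟩)]
      constructor
      · intro h
        exact h.lift g fun _ _ h => g.map_rel_iff.2 h
      · intro h
        have h' : Relation.ReflTransGen (SubtreeEdge v) (g.symm (g ⟨a.1, ha⟩))
            (g.symm (g ⟨x, hx⟩)) := h.lift g.symm fun _ _ h => g.symm.map_rel_iff.2 h
        simpa using h'
    have hw : Reach w (g ⟨a.1, ha⟩).1 := (g ⟨a.1, ha⟩).2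
    refine ⟨⟨⟨fun x => ⟨(g ⟨x.1, ha.trans x.2⟩).1, (hr _ (ha.trans x.2) _).1 x.2⟩,
      fun y => ⟨(g.symm ⟨y.1, hw.trans y.2⟩).1, ?_⟩, fun x => ?_, fun y => ?_⟩, ?_⟩⟩
    · apply (hr _ (g.symm ⟨y.1, hw.trans y.2⟩).2 (g.symm ⟨y.1, hw.trans y.2⟩).2).2
      simpa using y.2
    · simp
    · simp
    · intro x y
      exact g.map_rel_iff (a := ⟨x.1, ha.trans x.2⟩) (b := ⟨y.1, ha.trans y.2⟩)

/-- The edge relation of a tree that consists of a root `none` and subtrees with roots `ρ a` and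
edge relations `r a`. -/
inductive JoinEdge {ι : Type u} {X : ι → Type u} (ρ : ∀ a, X a) (r : ∀ a, X a → X a → Prop) :
    Option (Σ a, X a) → Option (Σ a, X a) → Prop
  | root (a : ι) : JoinEdge ρ r none (some ⟨a, ρ a⟩)
  | edge (a : ι) (x y : X a) (h : r a x y) : JoinEdge ρ r (some ⟨a, x⟩) (some ⟨a, y⟩)

/-- A subtree is the join of the subtrees at the children of its root. -/
theorem IsDirectedTree.nonempty_join_relIso (hT : IsDirectedTree V) (v : V) :
    Nonempty (JoinEdge (ι := {a // Edge V v a}) (fun a => subtreeRoot a.1)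
      (fun a => SubtreeEdge a.1) ≃r SubtreeEdge v) := by
  let f : Option (Σ a : {a // Edge V v a}, {x // Reach a.1 x}) → {x // Reach v x} := fun o =>
    o.elim (subtreeRoot v) fun p => ⟨p.2.1, .head p.1.2 p.2.2⟩
  have hinj : Function.Injective f := by
    rintro (_ | ⟨⟨a, ha⟩, x, hx⟩) (_ | ⟨⟨b, hb⟩, y, hy⟩) h
    · rfl
    · obtain rfl : v = y := congrArg Subtype.val h
      exact (hT.not_reach_of_edge hb hy).elim
    · obtain rfl : x = v := congrArg Subtype.val h
      exact (hT.not_reach_of_edge ha hx).elim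
    · obtain rfl : x = y := congrArg Subtype.val h
      obtain rfl := hT.child_unique ha hb hx hy
      rfl
  have hsurj : Function.Surjective f := by
    rintro ⟨x, hx⟩
    rcases Relation.ReflTransGen.cases_head hx with rfl | ⟨a, ha, hax⟩
    · exact ⟨none, rfl⟩
    · exact ⟨some ⟨⟨a, ha⟩, x, hax⟩, rfl⟩
  refine ⟨⟨Equiv.ofBijective f ⟨hinj, hsurj⟩, ?_⟩⟩
  intro o o'
  constructor
  · rcases o with (_ | ⟨⟨a, ha⟩, x, hx⟩) <;> rcases o' with (_ | ⟨⟨b, hb⟩, y, hy⟩) <;> intro h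
    · exact (hT.not_reach_of_edge h .refl).elim
    · have h : Edge V v y := h
      obtain rfl := hT.child_unique hb h hy .refl
      exact JoinEdge.root (⟨b, hb⟩ : {a // Edge V v a})
    · have h : Edge V x v := h
      exact (hT.not_reach_of_edge h (.head ha hx)).elim
    · have h : Edge V x y := h
      obtain rfl := hT.child_unique ha hb (hx.tail h) hy
      exact JoinEdge.edge (ι := {a // Edge V v a}) (X := fun a => {x // Reach a.1 x}) ⟨a, ha⟩
        ⟨x, hx⟩ ⟨y, hy⟩ h
  · rintro (⟨a⟩ | ⟨a, x, y, h⟩)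
    · exact a.2
    · exact h

theorem JoinEdge.map {ι κ : Type u} {X : ι → Type u} {Y : κ → Type u} {ρ : ∀ a, X a}
    {σ : ∀ a, Y a} {r : ∀ a, X a → X a → Prop} {s : ∀ a, Y a → Y a → Prop} (f : ι → κ)
    (g : ∀ a, X a → Y (f a)) (hρ : ∀ a, g a (ρ a) = σ (f a))
    (hr : ∀ a x y, r a x y → s (f a) (g a x) (g a y)) {o o' : Option (Σ a, X a)}
    (h : JoinEdge ρ r o o') : JoinEdge σ s (o.map (Sigma.map f g)) (o'.map (Sigma.map f g)) := by
  cases h with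
  | root a => simpa [Sigma.map, hρ] using JoinEdge.root (ρ := σ) (r := s) (f a)
  | edge a x y h => exact .edge _ _ _ (hr _ _ _ h)

theorem JoinEdge.nonempty_relIso {ι κ : Type u} {X : ι → Type u} {Y : κ → Type u} {ρ : ∀ a, X a}
    {σ : ∀ a, Y a} {r : ∀ a, X a → X a → Prop} {s : ∀ a, Y a → Y a → Prop} (f : ι ≃ κ)
    (g : ∀ a, r a ≃r s (f a)) (hρ : ∀ a, g a (ρ a) = σ (f a)) :
    Nonempty (JoinEdge ρ r ≃r JoinEdge σ s) := by
  let E : (Σ a, X a) ≃ (Σ b, Y b) := Equiv.sigmaCongr f fun a => (g a).toEquiv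
  have hE : ∀ p, E p = ⟨f p.1, g p.1 p.2⟩ := fun p => rfl
  refine ⟨⟨Equiv.optionCongr E, ?_⟩⟩
  intro o o'
  constructor
  · intro h
    generalize hp : Equiv.optionCongr E o = p at h
    generalize hp' : Equiv.optionCongr E o' = p' at h
    cases h with
    | root b =>
      obtain ⟨a, rfl⟩ := f.surjective b
      obtain rfl : o = none := (Equiv.optionCongr E).injective hp
      obtain rfl : o' = some ⟨a, ρ a⟩ := (Equiv.optionCongr E).injective (by simp [hp', hE, hρ])
      exact .root a
    | edge b x y h =>
      obtain ⟨a, rfl⟩ := f.surjective b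
      obtain ⟨x, rfl⟩ := (g a).surjective x
      obtain ⟨y, rfl⟩ := (g a).surjective y
      obtain rfl : o = some ⟨a, x⟩ := (Equiv.optionCongr E).injective (by simp [hp, hE])
      obtain rfl : o' = some ⟨a, y⟩ := (Equiv.optionCongr E).injective (by simp [hp', hE])
      exact .edge a x y ((g a).map_rel_iff.1 h)
  · exact fun h => JoinEdge.map f (fun a => g a) hρ (fun a x y h => (g a).map_rel_iff.2 h) h

theorem IsDirectedTree.subtreeIso_iff (hT : IsDirectedTree V) {v w : V} :
    SubtreeIso v w ↔
      ∃ e : {a // Edge V v a} ≃ {b // Edge V w b}, ∀ a, SubtreeIso a.1 (e a).1 := by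
  refine ⟨hT.exists_children_equiv, ?_⟩
  rintro ⟨e, he⟩
  let g := fun a => Classical.choice (he a)
  obtain ⟨ev⟩ := hT.nonempty_join_relIso v
  obtain ⟨ew⟩ := hT.nonempty_join_relIso w
  obtain ⟨k⟩ := JoinEdge.nonempty_relIso (ρ := fun a : {a // Edge V v a} => subtreeRoot a.1)
    (σ := fun a : {a // Edge V w a} => subtreeRoot a.1)
    (r := fun a => SubtreeEdge a.1) (s := fun a => SubtreeEdge a.1) e g
    fun a => hT.map_subtreeRoot (g a)
  exact ⟨(ev.symm.trans k).trans ew⟩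

/-- Two subtrees are isomorphic if their roots have the same number of children, and every
isomorphism type of the subtrees at the children of the first root occurs equally often among
the children of the second one. -/
theorem IsDirectedTree.subtreeIso_of_ncard (hT : IsDirectedTree V) {v w : V}
    (h : {a | Edge V v a}.ncard = {b | Edge V w b}.ncard)
    (h' : ∀ a, Edge V v a →
      {c | Edge V v c ∧ SubtreeIso c a}.ncard = {c | Edge V w c ∧ SubtreeIso c a}.ncard) :
    SubtreeIso v w := by
  have := hT.1
  rw [hT.subtreeIso_iff]
  let F : ∀ v, {a // Edge V v a} → Quotient (subtreeSetoid V) := fun v a => ⟦a.1⟧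
  have hF : ∀ v a, Nat.card {c // F v c = ⟦a⟧} = {c | Edge V v c ∧ SubtreeIso c a}.ncard := by
    intro v a
    refine Nat.card_congr ⟨fun c => ⟨c.1.1, c.1.2, Quotient.exact c.2⟩,
      fun c => ⟨⟨c.1, c.2.1⟩, Quotient.sound c.2.2⟩, fun _ => rfl, fun _ => rfl⟩
  -- Types that do not occur below v have an empty fibre there, so embeddings exist for all types.
  -- Gluing them gives an injection of the children, which the equality of the totals turns into a
  -- bijection.
  have hemb : ∀ q, Nonempty ({c // F v c = q} ↪ {c // F w c = q}) := by
    intro q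
    by_cases hq : Nonempty {c // F v c = q}
    · obtain ⟨⟨a, ha⟩, rfl⟩ := hq
      have e : Nat.card {c // F v c = ⟦a⟧} = Nat.card {c // F w c = ⟦a⟧} := by
        rw [hF, hF, h' a ha]
      exact ⟨(Classical.choice (Finite.card_eq.1 e)).toEmbedding⟩
    · have := not_nonempty_iff.1 hq
      exact ⟨Function.Embedding.ofIsEmpty⟩
  let φ := fun q => Classical.choice (hemb q)
  let f : {a // Edge V v a} → {b // Edge V w b} := fun a => (φ _ ⟨a, rfl⟩).1
  have hf : ∀ a, F w (f a) = F v a := fun a => (φ _ ⟨a, rfl⟩).2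
  have hinj : Function.Injective f := by
    intro a b hab
    have key : ∀ {q q'} (_ : q = q') (x : {c // F v c = q}) (y : {c // F v c = q'}),
        (φ q x).1 = (φ q' y).1 → x.1 = y.1 := by
      rintro q _ rfl x y hxy
      exact congrArg Subtype.val ((φ q).injective (Subtype.ext hxy))
    exact key (by rw [← hf a, ← hf b, hab]) _ _ hab
  have hbij : Function.Bijective f := by
    have := Fintype.ofFinite {a // Edge V v a}
    have := Fintype.ofFinite {b // Edge V w b}
    refine (Fintype.bijective_iff_injective_and_card f).2 ⟨hinj, ?_⟩
    rw [← Nat.card_eq_fintype_card, ← Nat.card_eq_fintype_card]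
    exact h
  exact ⟨Equiv.ofBijective f hbij, fun a => (Quotient.exact (hf a)).symm⟩

end Tree

/-! ### The recursion graph and its in-degrees -/

section Recursion

variable {V : Type u} [digraphVocabulary.Structure V]

/-- The statements about a pair of vertices that are evaluated by the recursion. -/
inductive Kind
  /-- the subtrees at `v` and `w` are isomorphic -/
  | iso
  /-- some child of `w` matches `a` -/
  | child
  /-- `b` matches `a` -/
  | pair
  /-- as many siblings of `a` as of `b` have the isomorphism type of `a` and `b` -/
  | balance
  /-- the subtrees at `a` and `b` are not isomorphic -/
  | nonIso

/-- The graph along which the recursion proceeds. -/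
def NodeEdge : Kind × V × V → Kind × V × V → Prop
  | (.iso, v, w), (.child, a, w') => w' = w ∧ Edge V v a
  -- Requiring `mult a = mult b` lets the in-degrees that depend on b be charged to the subtree at
  -- the parent of a.
  | (.child, a, w), (.pair, a', b) => a' = a ∧ Edge V w b ∧ size a = size b ∧ mult a = mult b
  | (.pair, a, b), (.iso, a', b') => a' = a ∧ b' = b
  | (.pair, a, b), (.balance, a', b') => a' = a ∧ b' = b
  | (.balance, a, b), (.iso, a', b') => b' = b ∧ Twin a a'
  | (.balance, a, b), (.nonIso, a', b') => a' = a ∧ Twin b b'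
  -- Without the twin condition every `iso` node would gain an in-neighbour, and on a long path the
  -- resource would be halved at each level.
  | (.nonIso, a, b), (.iso, a', b') => a' = a ∧ b' = b ∧ ∃ c, Twin b c
  | _, _ => False

/-- The labels of the graph along which the recursion proceeds. -/
def nodeLabel : Kind × V × V → Set ℕ
  | (.iso, v, w) => {N | N = {a | Edge V v a}.ncard ∧ N = {b | Edge V w b}.ncard}
  -- The bound keeps the label within the range of a single number variable.
  | (.child, _, _) => {N | N ≤ Nat.card V ∧ 0 < N}
  | (.pair, _, _) => {N | N ≤ Nat.card V ∧ 2 ≤ N}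
  | (.balance, _, b) => {N | N = mult b}
  | (.nonIso, _, _) => {N | N = 0}

/-- The in-degree of a node. -/
noncomputable def inDegree (x : Kind × V × V) : ℕ := {y | NodeEdge y x}.ncard

theorem inDegree_pos [Finite V] {x y : Kind × V × V} (h : NodeEdge y x) : 0 < inDegree x := by
  have : Finite Kind := Finite.of_injective (β := Fin 5)
    (fun k => match k with | .iso => 0 | .child => 1 | .pair => 2 | .balance => 3 | .nonIso => 4)
    (by rintro (_ | _) (_ | _) <;> simp)
  exact (Set.ncard_pos (Set.toFinite _)).2 ⟨y, h⟩

/-- The relation defined by limited recursion. -/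
abbrev NodeRel (x : Kind × V × V) (l : ℕ) : Prop := recRel NodeEdge nodeLabel x l

theorem nodeRel_iff (x : Kind × V × V) (l : ℕ) : NodeRel x l ↔
    0 < l ∧ {y | NodeEdge x y ∧ NodeRel y ((l - 1) / inDegree y)}.ncard ∈ nodeLabel x :=
  recRel_iff _ _ _ _

theorem inDegree_nonIso (a b : V) :
    inDegree (Kind.nonIso, a, b) = mult b := by
  have e : {y | NodeEdge y (Kind.nonIso, a, b)} =
      (fun c => (Kind.balance, a, c)) '' {c | Twin b c} := by
    ext ⟨k, x, y⟩
    cases k <;> simp [NodeEdge]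
    constructor
    · rintro ⟨rfl, h⟩
      exact ⟨h.symm, rfl⟩
    · rintro ⟨h, rfl⟩
      exact ⟨rfl, h.symm⟩
  rw [inDegree, e, Set.ncard_image_of_injective _ (fun _ _ h => by simpa using h)]
  rfl

theorem inDegree_balance (a b : V) :
    inDegree (Kind.balance, a, b) = 1 := by
  rw [inDegree, Set.ncard_eq_one]
  refine ⟨(.pair, a, b), ?_⟩
  ext ⟨k, x, y⟩
  cases k <;> simp [NodeEdge, eq_comm]

/-- The only out-neighbour is `iso (a, b)`, present because b has a twin; the label {0} then
expresses negation. -/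
theorem nodeRel_nonIso {a b c : V} (h : Twin b c) (l : ℕ) :
    NodeRel (Kind.nonIso, a, b) l ↔
      0 < l ∧ ¬ NodeRel (Kind.iso, a, b) ((l - 1) / inDegree (Kind.iso, a, b)) := by
  rw [nodeRel_iff]
  have e : {y | NodeEdge (Kind.nonIso, a, b) y ∧ NodeRel y ((l - 1) / inDegree y)} =
      {y | y = (Kind.iso, a, b) ∧
        NodeRel (Kind.iso, a, b) ((l - 1) / inDegree (Kind.iso, a, b))} := by
    ext ⟨k, x, y⟩
    cases k <;> simp [NodeEdge]
    constructor
    · rintro ⟨⟨rfl, rfl, -⟩, h'⟩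
      exact ⟨⟨rfl, rfl⟩, h'⟩
    · rintro ⟨⟨rfl, rfl⟩, h'⟩
      exact ⟨⟨rfl, rfl, c, h⟩, h'⟩
  rw [e]
  by_cases h : NodeRel (Kind.iso, a, b) ((l - 1) / inDegree (Kind.iso, a, b)) <;>
    simp [h, nodeLabel]

theorem nodeRel_balance [Finite V] {a b : V} (l : ℕ) :
    NodeRel (Kind.balance, a, b) l ↔ 0 < l ∧
      {c | Twin a c ∧ NodeRel (Kind.iso, c, b) ((l - 1) / inDegree (Kind.iso, c, b))}.ncard +
      {c | Twin b c ∧ NodeRel (Kind.nonIso, a, c) ((l - 1) / inDegree (Kind.nonIso, a, c))}.ncard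
        = mult b := by
  rw [nodeRel_iff]
  have e : {y | NodeEdge (Kind.balance, a, b) y ∧ NodeRel y ((l - 1) / inDegree y)} =
      (fun c => (Kind.iso, c, b)) '' {c | Twin a c ∧
        NodeRel (Kind.iso, c, b) ((l - 1) / inDegree (Kind.iso, c, b))} ∪
      (fun c => (Kind.nonIso, a, c)) '' {c | Twin b c ∧
        NodeRel (Kind.nonIso, a, c) ((l - 1) / inDegree (Kind.nonIso, a, c))} := by
    ext ⟨k, x, y⟩
    cases k <;> simp [NodeEdge] <;> grind
  rw [e, Set.ncard_union_eq, Set.ncard_image_of_injective _ (fun _ _ h => by simpa using h),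
    Set.ncard_image_of_injective _ (fun _ _ h => by simpa using h)]
  · rfl
  · rw [Set.disjoint_left]
    rintro _ ⟨c, -, rfl⟩ ⟨d, -, h⟩
    simp at h

/-! ### Evaluation of the recursion on trees -/

namespace IsDirectedTree

theorem inDegree_child (hT : IsDirectedTree V) {v a w : V} (h : Edge V v a) :
    inDegree (Kind.child, a, w) = 1 := by
  rw [inDegree, Set.ncard_eq_one]
  refine ⟨(.iso, v, w), ?_⟩
  ext ⟨k, x, y⟩
  cases k <;> simp [NodeEdge]
  constructor
  · rintro ⟨rfl, h'⟩
    exact ⟨hT.parent_unique h' h, rfl⟩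
  · rintro ⟨rfl, rfl⟩
    exact ⟨rfl, h⟩

theorem inDegree_pair (hT : IsDirectedTree V) {a w b : V} (h : Edge V w b)
    (hs : size a = size b) (hm : mult a = mult b) : inDegree (Kind.pair, a, b) = 1 := by
  rw [inDegree, Set.ncard_eq_one]
  refine ⟨(.child, a, w), ?_⟩
  ext ⟨k, x, y⟩
  cases k <;> simp [NodeEdge]
  constructor
  · rintro ⟨rfl, h', -⟩
    exact ⟨rfl, hT.parent_unique h' h⟩
  · rintro ⟨rfl, rfl⟩
    exact ⟨rfl, h, hs, hm⟩

/-- The in-neighbours are among the `balance` nodes of the twins of a, the node `pair (a, b)`, and,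
if b has a twin, `nonIso (a, b)`. -/
theorem inDegree_iso_le (hT : IsDirectedTree V) (a b : V) :
    inDegree (Kind.iso, a, b) ≤ mult a + 1 + (if 0 < mult b then 1 else 0) := by
  have := hT.1
  have e : {y | NodeEdge y (Kind.iso, a, b)} ⊆
      (fun c => (Kind.balance, c, b)) '' {c | Twin a c} ∪ {(Kind.pair, a, b)} ∪
        (if 0 < mult b then {(Kind.nonIso, a, b)} else ∅) := by
    rintro ⟨k, x, y⟩ h
    cases k <;> simp [NodeEdge] at h ⊢
    · simp [h]
    · exact ⟨h.2.symm, h.1⟩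
    · obtain ⟨rfl, rfl, c, hc⟩ := h
      simp [hT.mult_pos_of_twin hc]
  refine (Set.ncard_le_ncard e (by split_ifs <;> exact Set.toFinite _)).trans ?_
  refine (Set.ncard_union_le _ _).trans (add_le_add ((Set.ncard_union_le _ _).trans
    (add_le_add ?_ (by simp))) ?_)
  · exact Set.ncard_image_le (Set.toFinite _)
  · split_ifs <;> simp

theorem nodeRel_pair (hT : IsDirectedTree V) {w a b : V} (h : Edge V w b) (l : ℕ) :
    NodeRel (Kind.pair, a, b) l ↔ 0 < l ∧
      NodeRel (Kind.iso, a, b) ((l - 1) / inDegree (Kind.iso, a, b)) ∧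
      NodeRel (Kind.balance, a, b) (l - 1) := by
  rw [nodeRel_iff]
  have := hT.1
  have hsub : {y | NodeEdge (Kind.pair, a, b) y ∧ NodeRel y ((l - 1) / inDegree y)} ⊆
      {(Kind.iso, a, b), (Kind.balance, a, b)} := by
    rintro ⟨k, x, y⟩ ⟨h, -⟩
    cases k <;> simp_all [NodeEdge]
  have h2 : ({(Kind.iso, a, b), (Kind.balance, a, b)} : Set (Kind × V × V)).ncard = 2 :=
    Set.ncard_pair (by simp)
  -- The label contains 2 only if |V| ≥ 2; here b and its parent are two vertices.
  have hle : 2 ≤ Nat.card V := by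
    rw [← Set.ncard_pair (hT.ne_of_edge h), ← Set.ncard_univ]
    exact Set.ncard_le_ncard (Set.subset_univ _)
  have hfin : ({(Kind.iso, a, b), (Kind.balance, a, b)} : Set (Kind × V × V)).Finite := by simp
  refine and_congr_right fun _ => ?_
  constructor
  · rintro ⟨-, hc⟩
    have e := Set.eq_of_subset_of_ncard_le hsub (by rw [h2]; exact hc) hfin
    have e₁ : (Kind.iso, a, b) ∈ ({(Kind.iso, a, b), (Kind.balance, a, b)} : Set _) := by simp
    have e₂ : (Kind.balance, a, b) ∈ ({(Kind.iso, a, b), (Kind.balance, a, b)} : Set _) := by simp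
    rw [← e] at e₁ e₂
    refine ⟨e₁.2, ?_⟩
    simpa [inDegree_balance] using e₂.2
  · rintro ⟨h₁, h₂⟩
    have e : {y | NodeEdge (Kind.pair, a, b) y ∧ NodeRel y ((l - 1) / inDegree y)} =
        {(Kind.iso, a, b), (Kind.balance, a, b)} := by
      refine hsub.antisymm ?_
      rintro y (rfl | rfl)
      · exact ⟨⟨rfl, rfl⟩, h₁⟩
      · exact ⟨⟨rfl, rfl⟩, by simpa [inDegree_balance] using h₂⟩
    rw [e, h2]
    exact ⟨hle, le_rfl⟩

theorem nodeRel_child (hT : IsDirectedTree V) {a w : V} (l : ℕ) :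
    NodeRel (Kind.child, a, w) l ↔ 0 < l ∧
      ∃ b, Edge V w b ∧ size a = size b ∧ mult a = mult b ∧ NodeRel (Kind.pair, a, b) (l - 1) := by
  rw [nodeRel_iff]
  have := hT.1
  have e : {y | NodeEdge (Kind.child, a, w) y ∧ NodeRel y ((l - 1) / inDegree y)} =
      (fun b => (Kind.pair, a, b)) '' {b | Edge V w b ∧ size a = size b ∧ mult a = mult b ∧
        NodeRel (Kind.pair, a, b) (l - 1)} := by
    ext ⟨k, x, y⟩
    cases k <;> simp [NodeEdge]
    constructor
    · rintro ⟨⟨rfl, h, hs, hm⟩, h'⟩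
      rw [hT.inDegree_pair h hs hm, Nat.div_one] at h'
      exact ⟨⟨h, hs, hm, h'⟩, rfl⟩
    · rintro ⟨⟨h, hs, hm, h'⟩, rfl⟩
      rw [hT.inDegree_pair h hs hm, Nat.div_one]
      exact ⟨⟨rfl, h, hs, hm⟩, h'⟩
  rw [e, Set.ncard_image_of_injective _ (fun _ _ h => by simpa using h)]
  refine and_congr_right fun _ => ?_
  change _ ≤ _ ∧ _ ↔ _
  rw [Set.ncard_pos (Set.toFinite _), ← Set.ncard_univ]
  exact and_iff_right (Set.ncard_le_ncard (Set.subset_univ _))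

/-- The number of successful children of v must equal the number of all of them, so counting
replaces the universal quantifier. -/
theorem nodeRel_iso (hT : IsDirectedTree V) {v w : V} (l : ℕ) :
    NodeRel (Kind.iso, v, w) l ↔ 0 < l ∧
      {a | Edge V v a}.ncard = {b | Edge V w b}.ncard ∧
      ∀ a, Edge V v a → NodeRel (Kind.child, a, w) (l - 1) := by
  rw [nodeRel_iff]
  have := hT.1
  have e : {y | NodeEdge (Kind.iso, v, w) y ∧ NodeRel y ((l - 1) / inDegree y)} =
      (fun a => (Kind.child, a, w)) '' {a | Edge V v a ∧ NodeRel (Kind.child, a, w) (l - 1)} := by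
    ext ⟨k, x, y⟩
    cases k <;> simp [NodeEdge]
    constructor
    · rintro ⟨⟨rfl, h⟩, h'⟩
      rw [hT.inDegree_child h, Nat.div_one] at h'
      exact ⟨⟨h, h'⟩, rfl⟩
    · rintro ⟨⟨h, h'⟩, rfl⟩
      rw [hT.inDegree_child h, Nat.div_one]
      exact ⟨⟨rfl, h⟩, h'⟩
  rw [e, Set.ncard_image_of_injective _ (fun _ _ h => by simpa using h)]
  refine and_congr_right fun _ => ?_
  change _ = _ ∧ _ = _ ↔ _
  have hsub : {a | Edge V v a ∧ NodeRel (Kind.child, a, w) (l - 1)} ⊆ {a | Edge V v a} :=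
    fun a h => h.1
  constructor
  · rintro ⟨h, h'⟩
    refine ⟨h.symm.trans h', fun a ha => ?_⟩
    have := Set.eq_of_subset_of_ncard_le hsub h.ge
    exact (this.ge ha).2
  · rintro ⟨h, h'⟩
    have : {a | Edge V v a ∧ NodeRel (Kind.child, a, w) (l - 1)} = {a | Edge V v a} :=
      hsub.antisymm fun a ha => ⟨ha, h' a ha⟩
    rw [this]
    exact ⟨rfl, h⟩

theorem ncard_twin_add_one (hT : IsDirectedTree V) {v a : V} (h : Edge V v a) {p : V → Prop}
    (hp : ∀ c, p c → size a = size c) (ha : p a) :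
    {c | Edge V v c ∧ p c}.ncard = {c | Twin a c ∧ p c}.ncard + 1 := by
  have := hT.1
  rw [← Set.ncard_insert_of_notMem (a := a) (fun h => h.1.1 rfl)]
  congr 1
  ext c
  simp only [Set.mem_ofPred_eq, Set.mem_insert_iff, hT.twin_iff h]
  grind

theorem ncard_children_eq (hT : IsDirectedTree V) {v w : V} (h : SubtreeIso v w)
    {p : V → Prop} (hp : ∀ a b, SubtreeIso a b → (p a ↔ p b)) :
    {c | Edge V v c ∧ p c}.ncard = {c | Edge V w c ∧ p c}.ncard := by
  obtain ⟨e, he⟩ := hT.subtreeIso_iff.1 h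
  refine Nat.card_congr ⟨fun c => ⟨(e ⟨c.1, c.2.1⟩).1, (e ⟨c.1, c.2.1⟩).2,
      (hp _ _ (he ⟨c.1, c.2.1⟩)).1 c.2.2⟩,
    fun c => ⟨(e.symm ⟨c.1, c.2.1⟩).1, (e.symm ⟨c.1, c.2.1⟩).2,
      (hp _ _ (he (e.symm ⟨c.1, c.2.1⟩))).2 (by simpa using c.2.2)⟩, fun c => ?_, fun c => ?_⟩
  · simp
  · simp

/-- The twins of b split into those isomorphic to a and the rest, which number `mult b` in total;
cancelling the rest leaves an equality between the twins of the common type. Adding a and b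
themselves gives all children of that type. -/
theorem ncard_twin_iso_add_eq_iff (hT : IsDirectedTree V) {v w a b : V} (ha : Edge V v a)
    (hb : Edge V w b) (h : SubtreeIso a b) :
    {c | Twin a c ∧ SubtreeIso c b}.ncard + {c | Twin b c ∧ ¬ SubtreeIso a c}.ncard = mult b ↔
      {c | Edge V v c ∧ SubtreeIso c a}.ncard = {c | Edge V w c ∧ SubtreeIso c a}.ncard := by
  have := hT.1
  rw [hT.ncard_twin_add_one ha (p := fun c => SubtreeIso c a)
      (fun c hc => hc.size_eq.symm) (.refl a),
    hT.ncard_twin_add_one hb (p := fun c => SubtreeIso c a)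
      (fun c hc => h.size_eq.symm.trans hc.size_eq.symm) h.symm]
  have e₁ : {c | Twin a c ∧ SubtreeIso c b} = {c | Twin a c ∧ SubtreeIso c a} := by
    ext c
    exact and_congr_right fun _ => ⟨fun h' => h'.trans h.symm, fun h' => h'.trans h⟩
  have e₂ : {c | Twin b c ∧ SubtreeIso c a}.ncard + {c | Twin b c ∧ ¬ SubtreeIso a c}.ncard =
      mult b := by
    rw [mult, ← Set.ncard_union_eq]
    · congr 1
      ext c
      simp only [Set.mem_union, Set.mem_ofPred_eq]
      have : SubtreeIso c a ↔ SubtreeIso a c := ⟨.symm, .symm⟩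
      tauto
    · rw [Set.disjoint_left]
      rintro c ⟨-, h₁⟩ ⟨-, h₂⟩
      exact h₂ h₁.symm
  rw [e₁]
  omega

theorem subtreeIso_iff_matching (hT : IsDirectedTree V) {v w : V} :
    SubtreeIso v w ↔ {a | Edge V v a}.ncard = {b | Edge V w b}.ncard ∧
      ∀ a, Edge V v a → ∃ b, Edge V w b ∧ size a = size b ∧ mult a = mult b ∧ SubtreeIso a b ∧
        {c | Twin a c ∧ SubtreeIso c b}.ncard + {c | Twin b c ∧ ¬ SubtreeIso a c}.ncard =
          mult b := by
  constructor
  · intro h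
    refine ⟨by simpa using hT.ncard_children_eq h (p := fun _ => True) (by simp), fun a ha => ?_⟩
    obtain ⟨e, he⟩ := hT.subtreeIso_iff.1 h
    have hab := he ⟨a, ha⟩
    have hb := (e ⟨a, ha⟩).2
    refine ⟨_, hb, hab.size_eq, ?_, hab, (hT.ncard_twin_iso_add_eq_iff ha hb hab).2 ?_⟩
    · have h₁ := hT.ncard_children_eq h (p := fun c => size a = size c)
        (fun c d hcd => by rw [hcd.size_eq])
      rw [hT.ncard_twin_add_one ha (fun c hc => hc) rfl,
        hT.ncard_twin_add_one hb (fun c hc => hab.size_eq.symm.trans hc) hab.size_eq] at h₁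
      have h₂ : ∀ c : V, size c = size a → {d | Twin c d ∧ size a = size d} = {d | Twin c d} := by
        intro c hc
        ext d
        exact and_iff_left_of_imp fun h => hc.symm.trans h.size_eq
      rw [h₂ _ rfl, h₂ _ hab.size_eq.symm] at h₁
      exact Nat.succ_injective h₁
    · exact hT.ncard_children_eq h (p := fun c => SubtreeIso c a)
        (fun c d hcd => ⟨fun h => hcd.symm.trans h, fun h => hcd.trans h⟩)
  · rintro ⟨h, h'⟩
    refine hT.subtreeIso_of_ncard h fun a ha => ?_
    obtain ⟨b, hb, -, -, hab, e⟩ := h' a ha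
    exact (hT.ncard_twin_iso_add_eq_iff ha hb hab).1 e

/-- Limited recursion decides the isomorphism of subtrees if it is granted resources that are
quadratic in their size. -/
theorem nodeRel_iso_iff (hT : IsDirectedTree V) {v w : V} (h : size v = size w) {l : ℕ}
    (hl : size v ^ 2 ≤ l) : NodeRel (Kind.iso, v, w) l ↔ SubtreeIso v w := by
  have := hT.1
  induction hn : size v using Nat.strong_induction_on generalizing v w l with
  | _ n ih =>
  have hlpos : 0 < l := lt_of_lt_of_le (pow_pos (hT.size_pos v) 2) hl
  -- The in-neighbour x only serves to make the in-degree positive, so that the division can be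
  -- inverted.
  have IH : ∀ {a b : V} {x : Kind × V × V}, size a < n → size a = size b →
      NodeEdge x (Kind.iso, a, b) → ∀ l',
      size a ^ 2 * (mult a + 1 + if 0 < mult b then 1 else 0) ≤ l' →
      (NodeRel (Kind.iso, a, b) (l' / inDegree (Kind.iso, a, b)) ↔ SubtreeIso a b) := by
    intro a b x ha hab hx l' hl'
    refine ih _ ha hab ?_ rfl
    rw [Nat.le_div_iff_mul_le (inDegree_pos hx)]
    exact (Nat.mul_le_mul_left _ (hT.inDegree_iso_le a b)).trans hl'
  rw [hT.nodeRel_iso, hT.subtreeIso_iff_matching, and_iff_right hlpos]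
  refine and_congr_right fun _ => forall₂_congr fun a ha => ?_
  have hlt := hT.mult_mul_size_lt ha
  have hapos := hT.size_pos a
  -- the resources left after four steps
  have hres : (0 < mult a ∧ mult a * (size a ^ 2 * (mult a + 2) + 1) + 4 ≤ l) ∨
      (mult a = 0 ∧ size a ^ 2 + 3 ≤ l) := by
    -- As (m + 1)² = m(m + 2) + 1, the square exceeds m(m + 2)s² by s² + 2(m + 1)s + 1. This covers
    -- the further m + 4 if m > 0, and leaves s² + 3 if m = 0.
    have h2 : ((mult a + 1) * size a + 1) ^ 2 ≤ l := (Nat.pow_le_pow_left hlt 2).trans hl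
    rcases Nat.eq_zero_or_pos (mult a) with h0 | h0
    · right
      rw [h0] at h2
      exact ⟨h0, by nlinarith⟩
    · left
      refine ⟨h0, le_trans ?_ h2⟩
      have : mult a ≤ mult a * size a := Nat.le_mul_of_pos_right _ hapos
      have : 1 ≤ size a ^ 2 := Nat.one_le_pow _ _ hapos
      nlinarith
  have halt : size a < n := by
    rw [← hn]
    have : size a ≤ (mult a + 1) * size a := Nat.le_mul_of_pos_left _ (by omega)
    omega
  rw [hT.nodeRel_child]
  have h1 : 0 < l - 1 := by
    rcases hres with h | h <;> omega
  rw [and_iff_right h1]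
  refine exists_congr fun b => and_congr_right fun hb => and_congr_right fun hs =>
    and_congr_right fun hm => ?_
  have h2 : 0 < l - 1 - 1 := by
    rcases hres with h | h <;> omega
  have h3 : 0 < l - 1 - 1 - 1 := by
    rcases hres with h | h
    · omega
    · have : 1 ≤ size a ^ 2 := Nat.one_le_pow _ _ hapos
      omega
  have hres3 : size a ^ 2 * (mult a + 1 + if 0 < mult b then 1 else 0) ≤ l - 1 - 1 - 1 := by
    rw [← hm]
    rcases hres with ⟨h0, h⟩ | ⟨h, h'⟩
    · have : size a ^ 2 * (mult a + 2) + 1 ≤ mult a * (size a ^ 2 * (mult a + 2) + 1) :=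
        Nat.le_mul_of_pos_left _ h0
      have : mult a + 1 + 1 = mult a + 2 := rfl
      rw [if_pos h0, this]
      omega
    · rw [h]; simp; omega
  rw [hT.nodeRel_pair hb, and_iff_right h2, nodeRel_balance, and_iff_right h3,
    IH (x := (Kind.pair, a, b)) halt hs ⟨rfl, rfl⟩ _ hres3]
  refine and_congr_right fun hab => ?_
  have e₁ : {c | Twin a c ∧ NodeRel (Kind.iso, c, b)
      ((l - 1 - 1 - 1 - 1) / inDegree (Kind.iso, c, b))} = {c | Twin a c ∧ SubtreeIso c b} := by
    ext c
    refine and_congr_right fun hc => ?_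
    have h0 := hT.mult_pos_of_twin hc
    have hres4 : size a ^ 2 * (mult a + 1 + if 0 < mult b then 1 else 0) ≤ l - 1 - 1 - 1 - 1 := by
      rcases hres with h | h
      · have : size a ^ 2 * (mult a + 2) + 1 ≤ mult a * (size a ^ 2 * (mult a + 2) + 1) :=
          Nat.le_mul_of_pos_left _ h0
        have : mult a + 1 + 1 = mult a + 2 := rfl
        rw [← hm, if_pos h0, this]
        omega
      · omega
    rw [hc.size_eq, hT.mult_eq_of_twin hc] at hres4
    exact IH (x := (Kind.balance, a, b)) (hc.size_eq ▸ halt) (hc.size_eq.symm.trans hs)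
      ⟨rfl, hc⟩ _ hres4
  have e₂ : {c | Twin b c ∧ NodeRel (Kind.nonIso, a, c)
      ((l - 1 - 1 - 1 - 1) / inDegree (Kind.nonIso, a, c))} =
      {c | Twin b c ∧ ¬ SubtreeIso a c} := by
    ext c
    refine and_congr_right fun hc => ?_
    have hbc := hT.mult_eq_of_twin hc
    have h0 : 0 < mult a := hm ▸ hT.mult_pos_of_twin hc
    -- This is the costliest branch: after division by the in-degree m of `nonIso`, one more unit
    -- and a factor of at most m + 2 remain to be paid.
    have h5 : size a ^ 2 * (mult a + 2) + 1 ≤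
        (l - 1 - 1 - 1 - 1) / inDegree (Kind.nonIso, a, c) := by
      rw [inDegree_nonIso, ← hbc, ← hm, Nat.le_div_iff_mul_le h0, mul_comm]
      rcases hres with h | h <;> omega
    rw [nodeRel_nonIso hc.symm, and_iff_right (by omega), not_iff_not]
    refine IH (x := (Kind.nonIso, a, c)) halt (hs.trans hc.size_eq) ⟨rfl, rfl, b, hc.symm⟩ _ ?_
    rw [← hbc, ← hm, if_pos h0]
    exact Nat.le_sub_one_of_lt h5
  rw [e₁, e₂]

end IsDirectedTree

end Recursion

/-! ### Transfer of limited recursion along an injection -/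

section Transfer

/-- All edges of the second graph lie inside the image of f, so points outside it contribute neither
to in-degrees nor to counts. -/
theorem recRel_map {A B : Type*} {E : A → A → Prop} {C : A → Set ℕ} {E' : B → B → Prop}
    {C' : B → Set ℕ} {f : A → B} (hf : Function.Injective f)
    (hE : ∀ b b', E' b b' ↔ ∃ a a', f a = b ∧ f a' = b' ∧ E a a') (hC : ∀ a, C' (f a) = C a)
    (a : A) (l : ℕ) : recRel E' C' (f a) l ↔ recRel E C a l := by
  induction l using Nat.strong_induction_on generalizing a with
  | _ l ih =>
  rw [recRel_iff, recRel_iff, hC]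
  refine and_congr_right fun hl => ?_
  have hE' : ∀ a a', E' (f a) (f a') ↔ E a a' := by
    intro a a'
    rw [hE]
    constructor
    · rintro ⟨c, c', h, h', hc⟩
      rwa [← hf h, ← hf h']
    · exact fun h => ⟨a, a', rfl, rfl, h⟩
  have hin : ∀ c, {b | E' b (f c)}.ncard = {c' | E c' c}.ncard := by
    intro c
    rw [← Set.ncard_image_of_injective _ hf]
    congr 1
    ext b
    constructor
    · intro h
      obtain ⟨c', -, rfl, -, -⟩ := (hE _ _).1 h
      exact ⟨c', (hE' _ _).1 h, rfl⟩
    · rintro ⟨c', h, rfl⟩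
      exact (hE' _ _).2 h
  have e : {b | E' (f a) b ∧ recRel E' C' b ((l - 1) / {a' | E' a' b}.ncard)} =
      f '' {b | E a b ∧ recRel E C b ((l - 1) / {a' | E a' b}.ncard)} := by
    have hlt : ∀ d, (l - 1) / d < l := fun d => lt_of_le_of_lt (Nat.div_le_self _ _) (by omega)
    ext b
    constructor
    · rintro ⟨h, h'⟩
      obtain ⟨-, c, -, rfl, -⟩ := (hE _ _).1 h
      rw [hin, ih _ (hlt _)] at h'
      exact ⟨c, ⟨(hE' _ _).1 h, h'⟩, rfl⟩
    · rintro ⟨c, ⟨h, h'⟩, rfl⟩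
      refine ⟨(hE' _ _).2 h, ?_⟩
      rwa [hin, ih _ (hlt _)]
  rw [e, Set.ncard_image_of_injective _ hf]

end Transfer

/-! ### Assignments and values of single variables -/

section Assignments

variable {V : Type u}

/-- The value of a structure variable. -/
def Assignment.elt (α : Assignment V) (x : ℕ) : V := α ⟨.elt, x⟩

/-- The value of a number variable. -/
def Assignment.num (α : Assignment V) (p : ℕ) : ℕ := numVal (α ⟨.num, p⟩)

/-- The assignment that changes the value of one structure variable. -/
noncomputable def Assignment.setElt (α : Assignment V) (x : ℕ) (a : V) : Assignment V :=
  α.update (fun _ : Fin 1 => .elt) (fun _ => x) (fun _ => a)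

/-- The assignment that changes the value of one number variable. -/
noncomputable def Assignment.setNum (α : Assignment V) (p : ℕ) (n : Dom V .num) : Assignment V :=
  α.update (fun _ : Fin 1 => .num) (fun _ => p) (fun _ => n)

theorem vars_one_injective (s : Srt) (x : ℕ) :
    Function.Injective (vars (fun _ : Fin 1 => s) fun _ => x) :=
  fun _ _ _ => Subsingleton.elim _ _

@[simp]
theorem Assignment.elt_setElt_self (α : Assignment V) (x : ℕ) (a : V) :
    (α.setElt x a).elt x = a :=
  α.update_of_mem _ _ (vars_one_injective .elt x) (fun _ => a) 0

theorem Assignment.elt_setElt_of_ne (α : Assignment V) {x y : ℕ} (h : x ≠ y) (a : V) :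
    (α.setElt y a).elt x = α.elt x :=
  α.update_of_notMem (fun _ : Fin 1 => .elt) (fun _ => y) (fun _ => a) ⟨.elt, x⟩
    fun _ => by simpa [vars] using h.symm

@[simp]
theorem Assignment.elt_setNum (α : Assignment V) (x p : ℕ) (n : Dom V .num) :
    (α.setNum p n).elt x = α.elt x :=
  α.update_of_notMem (fun _ : Fin 1 => .num) (fun _ => p) (fun _ => n) ⟨.elt, x⟩
    fun _ => by simp [vars]

@[simp]
theorem Assignment.num_setNum_self (α : Assignment V) (p : ℕ) (n : Dom V .num) :
    (α.setNum p n).num p = numVal n :=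
  congrArg numVal (α.update_of_mem _ _ (vars_one_injective .num p) (fun _ => n) 0)

theorem Assignment.num_setNum_of_ne (α : Assignment V) {p q : ℕ} (h : p ≠ q) (n : Dom V .num) :
    (α.setNum q n).num p = α.num p :=
  congrArg numVal (α.update_of_notMem _ _ _ _ fun _ => by simpa [vars] using h.symm)

theorem tuple_one_eq {s : Srt} (a : TupleDom V fun _ : Fin 1 => s) : (fun _ => a 0) = a := by
  funext i
  rw [Subsingleton.elim i 0]

/-- A vertex as a tuple. -/
def single (a : V) : TupleDom V fun _ : Fin 1 => .elt := fun _ => a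

theorem single_injective : Function.Injective (single (V := V)) := fun _ _ h => congrFun h 0

theorem single_apply_zero (b : TupleDom V fun _ : Fin 1 => .elt) : single (b 0) = b :=
  tuple_one_eq b

theorem numVal_le (n : Dom V .num) : numVal n ≤ Nat.card V := Nat.lt_succ_iff.1 n.down.2

theorem numVal_injective : Function.Injective (numVal (V := V)) := by
  rintro ⟨a⟩ ⟨b⟩ h
  exact congrArg ULift.up (Fin.ext h)

theorem exists_numVal_eq {k : ℕ} (h : k ≤ Nat.card V) : ∃ n : Dom V .num, numVal n = k :=
  ⟨⟨⟨k, Nat.lt_succ_iff.2 h⟩⟩, rfl⟩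

theorem tupleVal_one (n : TupleDom V fun _ : Fin 1 => .num) : tupleVal n = numVal (n 0) := by
  simp [tupleVal]

/-- The values of a label given by a single number variable. -/
theorem exists_tuple_one_iff {α : Assignment V} {p : ℕ} {P : Assignment V → Prop}
    {Q : ℕ → Prop} (h : ∀ n, P (α.setNum p n) ↔ Q (numVal n)) :
    {N | ∃ n : TupleDom V (fun _ : Fin 1 => .num),
      P (α.update (fun _ => .num) (fun _ => p) n) ∧ tupleVal n = N} =
      {N | N ≤ Nat.card V ∧ Q N} := by
  ext N
  constructor
  · rintro ⟨n, hn, rfl⟩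
    rw [← tuple_one_eq n] at hn
    rw [tupleVal_one]
    exact ⟨numVal_le _, (h (n 0)).1 hn⟩
  · rintro ⟨hN, hQ⟩
    obtain ⟨n, rfl⟩ := exists_numVal_eq hN
    exact ⟨fun _ => n, (h n).2 hQ, tupleVal_one _⟩

end Assignments

/-! ### Formulae for reachability, sizes and twins -/

section Formulas

/-- The formulae of the theorem. -/
abbrev GFormula : Type := Formula digraphVocabulary

/-- Disjunction. -/
def Formula.or {L : FirstOrder.Language.{0, 0}} (φ ψ : Formula L) : Formula L :=
  .not (.and (.not φ) (.not ψ))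

/-- `E(x, y)` -/
def edgeF (x y : ℕ) : GFormula := .rel FirstOrder.Language.adj ![x, y]

/-- `p = 0` -/
def zeroF (p : ℕ) : GFormula := .not (.ex ⟨.num, p + 1⟩ (.not (.le p (p + 1))))

/-- `p` is the greatest number. -/
def maxF (p : ℕ) : GFormula := .not (.ex ⟨.num, p + 1⟩ (.not (.le (p + 1) p)))

/-- `#x φ = p` -/
def countF (x : ℕ) (φ : GFormula) (p : ℕ) : GFormula :=
  .count (fun _ : Fin 1 => .elt) (fun _ => x) (vars_one_injective _ _) φ (fun _ : Fin 1 => p)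

/-- `y` belongs to the subtree rooted at `x`. -/
def reachF (x y : ℕ) : GFormula :=
  .ex ⟨.num, 0⟩ (.and (maxF 0)
    -- The names x + y + 1 and x + y + 2 differ from both x and y, which rules out capture.
    (.lrec (fun _ : Fin 1 => .elt) (fun _ => x + y + 1) (fun _ => x + y + 2)
      (vars_one_injective _ _) (vars_one_injective _ _) (by simp [vars])
      (fun _ : Fin 1 => 1) (vars_one_injective _ _)
      -- A vertex succeeds if it is y or some child succeeds.
      (edgeF (x + y + 1) (x + y + 2)) (.or (.eq .elt (x + y + 1) y) (.not (zeroF 1)))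
      (fun _ => x) (fun _ : Fin 1 => 0)))

/-- `#x φ = #x ψ` -/
def sameCountF (x : ℕ) (φ ψ : GFormula) : GFormula :=
  .ex ⟨.num, 2⟩ (.and (countF x φ 2) (countF x ψ 2))

/-- The subtrees at `x` and `y` have the same size. -/
def sizeEqF (x y : ℕ) : GFormula :=
  sameCountF (x + y + 1) (reachF x (x + y + 1)) (reachF y (x + y + 1))

/-- The vertices `x` and `y` are twins. -/
def twinF (x y : ℕ) : GFormula :=
  .and (.not (.eq .elt x y)) (.and
    (.ex ⟨.elt, x + y + 1⟩ (.and (edgeF (x + y + 1) x) (edgeF (x + y + 1) y))) (sizeEqF x y))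

/-- The vertices `x` and `y` have the same number of twins. -/
def multEqF (x y : ℕ) : GFormula :=
  sameCountF (x + y + 1) (twinF x (x + y + 1)) (twinF y (x + y + 1))

section Free

variable {L : FirstOrder.Language.{0, 0}} {S : Set Var}

theorem Formula.free_or_subset {φ ψ : Formula L} (h₁ : φ.free ⊆ S) (h₂ : ψ.free ⊆ S) :
    (φ.or ψ).free ⊆ S := Set.union_subset h₁ h₂

theorem Formula.free_and_subset {φ ψ : Formula L} (h₁ : φ.free ⊆ S) (h₂ : ψ.free ⊆ S) :
    (φ.and ψ).free ⊆ S := Set.union_subset h₁ h₂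

theorem Formula.free_ex_subset {φ : Formula L} {x : Var} (h : φ.free ⊆ insert x S) :
    (Formula.ex x φ).free ⊆ S := by
  rintro y ⟨hy, hxy⟩
  exact (h hy).resolve_left hxy

theorem free_edgeF (x y : ℕ) : (edgeF x y).free ⊆ {⟨.elt, x⟩, ⟨.elt, y⟩} := by
  rintro _ ⟨i, rfl⟩
  fin_cases i <;> simp [vars]

theorem free_zeroF (p : ℕ) : (zeroF p).free ⊆ {⟨.num, p⟩} :=
  Formula.free_ex_subset fun x hx => by
    simpa [Formula.free, or_comm] using hx

theorem free_maxF (p : ℕ) : (maxF p).free ⊆ {⟨.num, p⟩} :=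
  Formula.free_ex_subset fun x hx => by
    simpa [Formula.free, or_comm] using hx

theorem free_countF_subset {x : ℕ} {φ : GFormula} {p : ℕ}
    (h : φ.free ⊆ insert ⟨.elt, x⟩ S) (hp : ⟨.num, p⟩ ∈ S) : (countF x φ p).free ⊆ S := by
  rintro y (⟨hy, hy'⟩ | ⟨i, rfl⟩)
  · refine (h hy).resolve_left ?_
    rintro rfl
    exact hy' ⟨0, rfl⟩
  · exact hp

theorem free_reachF (x y : ℕ) : (reachF x y).free ⊆ {⟨.elt, x⟩, ⟨.elt, y⟩} := by
  refine Formula.free_ex_subset (Formula.free_and_subset ?_ ?_)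
  · exact (free_maxF 0).trans (by simp)
  · rintro v (((⟨hv, hv'⟩ | ⟨hv, hv'⟩) | ⟨i, rfl⟩) | ⟨i, rfl⟩)
    · refine (hv' ?_).elim
      rcases free_edgeF _ _ hv with rfl | rfl
      · exact .inl ⟨0, rfl⟩
      · exact .inr ⟨0, rfl⟩
    · rcases hv with (rfl | rfl) | hv
      · exact (hv' (.inl ⟨0, rfl⟩)).elim
      · simp
      · rcases free_zeroF _ hv with rfl
        exact (hv' (.inr ⟨0, rfl⟩)).elim
    · simp [vars]
    · simp [numVars, vars]

theorem free_sameCountF_subset {x : ℕ} {φ ψ : GFormula} (h₁ : φ.free ⊆ insert ⟨.elt, x⟩ S)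
    (h₂ : ψ.free ⊆ insert ⟨.elt, x⟩ S) : (sameCountF x φ ψ).free ⊆ S :=
  Formula.free_ex_subset (Formula.free_and_subset
    (free_countF_subset (h₁.trans (Set.insert_subset_insert (Set.subset_insert _ _))) (by simp))
    (free_countF_subset (h₂.trans (Set.insert_subset_insert (Set.subset_insert _ _))) (by simp)))

theorem free_sizeEqF (x y : ℕ) : (sizeEqF x y).free ⊆ {⟨.elt, x⟩, ⟨.elt, y⟩} :=
  free_sameCountF_subset ((free_reachF _ _).trans (by grind)) ((free_reachF _ _).trans (by grind))

theorem free_twinF (x y : ℕ) : (twinF x y).free ⊆ {⟨.elt, x⟩, ⟨.elt, y⟩} :=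
  Formula.free_and_subset subset_rfl (Formula.free_and_subset
    (Formula.free_ex_subset (Formula.free_and_subset ((free_edgeF _ _).trans (by grind))
      ((free_edgeF _ _).trans (by grind)))) (free_sizeEqF x y))

theorem free_multEqF (x y : ℕ) : (multEqF x y).free ⊆ {⟨.elt, x⟩, ⟨.elt, y⟩} :=
  free_sameCountF_subset ((free_twinF _ _).trans (by grind)) ((free_twinF _ _).trans (by grind))

end Free

variable {V : Type u} [digraphVocabulary.Structure V] (α : Assignment V)

section Basic

@[simp]
theorem sat_not {φ : GFormula} : α.Sat (.not φ) ↔ ¬ α.Sat φ := by simp only [Assignment.Sat]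

@[simp]
theorem sat_and {φ ψ : GFormula} : α.Sat (.and φ ψ) ↔ α.Sat φ ∧ α.Sat ψ := by
  simp only [Assignment.Sat]

@[simp]
theorem sat_or {φ ψ : GFormula} : α.Sat (.or φ ψ) ↔ α.Sat φ ∨ α.Sat ψ := by
  simp only [Formula.or, sat_not, sat_and]
  tauto

@[simp]
theorem sat_ex_elt {x : ℕ} {φ : GFormula} :
    α.Sat (.ex ⟨.elt, x⟩ φ) ↔ ∃ a : V, (α.setElt x a).Sat φ := by
  simp only [Assignment.Sat]
  rfl

@[simp]
theorem sat_ex_num {p : ℕ} {φ : GFormula} :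
    α.Sat (.ex ⟨.num, p⟩ φ) ↔ ∃ n : Dom V .num, (α.setNum p n).Sat φ := by
  simp only [Assignment.Sat]
  rfl

@[simp]
theorem sat_eq_elt {x y : ℕ} : α.Sat (.eq .elt x y : GFormula) ↔ α.elt x = α.elt y := by
  simp only [Assignment.Sat]
  rfl

@[simp]
theorem sat_eq_num {p q : ℕ} : α.Sat (.eq .num p q : GFormula) ↔ α.num p = α.num q := by
  simp only [Assignment.Sat]
  exact numVal_injective.eq_iff.symm

@[simp]
theorem sat_le {p q : ℕ} : α.Sat (.le p q : GFormula) ↔ α.num p ≤ α.num q := by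
  simp only [Assignment.Sat]
  rfl

@[simp]
theorem sat_edgeF {x y : ℕ} : α.Sat (edgeF x y) ↔ Edge V (α.elt x) (α.elt y) := by
  simp only [edgeF, Assignment.Sat, Edge]
  refine iff_of_eq (congrArg _ ?_)
  funext i
  fin_cases i <;> rfl

@[simp]
theorem sat_zeroF {p : ℕ} : α.Sat (zeroF p) ↔ α.num p = 0 := by
  simp only [zeroF, sat_not, sat_ex_num, sat_le, not_exists, not_not, α.num_setNum_self,
    α.num_setNum_of_ne (show p ≠ p + 1 by omega)]
  constructor
  · intro h
    obtain ⟨n, hn⟩ := exists_numVal_eq (V := V) (Nat.zero_le _)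
    exact Nat.le_zero.1 (hn ▸ h n)
  · intro h n
    omega

@[simp]
theorem sat_maxF {p : ℕ} : α.Sat (maxF p) ↔ α.num p = Nat.card V := by
  simp only [maxF, sat_not, sat_ex_num, sat_le, not_exists, not_not, α.num_setNum_self,
    α.num_setNum_of_ne (show p ≠ p + 1 by omega)]
  constructor
  · intro h
    obtain ⟨n, hn⟩ := exists_numVal_eq (V := V) le_rfl
    exact le_antisymm (numVal_le _) (hn ▸ h n)
  · intro h n
    exact h ▸ numVal_le n

theorem sat_countF {x : ℕ} {φ : GFormula} {p : ℕ} {P : V → Prop}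
    (h : ∀ a, (α.setElt x a).Sat φ ↔ P a) :
    α.Sat (countF x φ p) ↔ {a | P a}.ncard = α.num p := by
  simp only [countF, Assignment.Sat, tupleVal_one]
  have e : {a : TupleDom V (fun _ : Fin 1 => Srt.elt) | (α.update _ (fun _ => x) a).Sat φ} =
      single '' {a | P a} := by
    ext a
    constructor
    · intro ha
      refine ⟨a 0, (h (a 0)).1 ?_, single_apply_zero a⟩
      rw [← single_apply_zero a] at ha
      exact ha
    · rintro ⟨a, ha, rfl⟩
      exact (h a).2 ha
  rw [e, Set.ncard_image_of_injective _ single_injective]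
  rfl

theorem sat_sameCountF [Finite V] {x : ℕ} {φ ψ : GFormula} {P Q : V → Prop}
    (h₁ : ∀ n a, ((α.setNum 2 n).setElt x a).Sat φ ↔ P a)
    (h₂ : ∀ n a, ((α.setNum 2 n).setElt x a).Sat ψ ↔ Q a) :
    α.Sat (sameCountF x φ ψ) ↔ {a | P a}.ncard = {a | Q a}.ncard := by
  simp only [sameCountF, sat_ex_num, sat_and, sat_countF _ (h₁ _), sat_countF _ (h₂ _),
    Assignment.num_setNum_self]
  constructor
  · rintro ⟨n, h, h'⟩
    exact h.trans h'.symm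
  · intro h
    obtain ⟨n, hn⟩ := exists_numVal_eq (V := V) (k := {a | P a}.ncard) <| by
      rw [← Set.ncard_univ]
      exact Set.ncard_le_ncard (Set.subset_univ _)
    exact ⟨n, hn.symm, by rw [hn, h]⟩

end Basic

/-! ### Meaning of these formulae on trees -/

section OnTrees

variable {α}

/-- In-degrees are 1, so a step down costs one unit while the subtree loses at least one vertex. The
resource bound matters only for finding y; success always yields a path. -/
theorem IsDirectedTree.recRel_reach_iff (hT : IsDirectedTree V) {x y : V} {l : ℕ}
    (hl : size x ≤ l) :
    recRel (Edge V) (fun a => {N | N ≤ Nat.card V ∧ (a = y ∨ N ≠ 0)}) x l ↔ Reach x y := by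
  have := hT.1
  have hle : ∀ s : Set V, s.ncard ≤ Nat.card V := fun s => by
    rw [← Set.ncard_univ]
    exact Set.ncard_le_ncard (Set.subset_univ _)
  have hdeg : ∀ {a b}, Edge V a b → {a' | Edge V a' b}.ncard = 1 := fun {a b} h => by
    rw [Set.ncard_eq_one]
    exact ⟨a, Set.ext fun c => ⟨fun hc => hT.parent_unique hc h, fun hc => hc ▸ h⟩⟩
  constructor
  · clear hl
    intro h
    induction l using Nat.strong_induction_on generalizing x with
    | _ l ih =>
    rw [recRel_iff] at h
    obtain ⟨hl, -, rfl | h⟩ := h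
    · exact .refl
    · obtain ⟨a, ha, h⟩ := Set.nonempty_of_ncard_ne_zero h
      exact .head ha (ih _ (lt_of_le_of_lt (Nat.div_le_self _ _) (by omega)) h)
  · intro h
    induction h using Relation.ReflTransGen.head_induction_on generalizing l with
    | refl =>
      rw [recRel_iff]
      exact ⟨(hT.size_pos _).trans_le hl, hle _, .inl rfl⟩
    | @head a c ha h ih =>
      rw [recRel_iff]
      refine ⟨(hT.size_pos _).trans_le hl, hle _, .inr (Nat.pos_iff_ne_zero.1 ?_)⟩
      refine (Set.ncard_pos (Set.toFinite _)).2 ⟨c, ha, ?_⟩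
      rw [hdeg ha, Nat.div_one]
      refine ih ?_
      have h1 := hT.mult_mul_size_lt ha
      have h2 : size c ≤ (mult c + 1) * size c := Nat.le_mul_of_pos_left _ (by omega)
      omega

theorem IsDirectedTree.size_le (hT : IsDirectedTree V) (v : V) : size v ≤ Nat.card V := by
  have := hT.1
  rw [← Set.ncard_univ]
  exact Set.ncard_le_ncard (Set.subset_univ _)

theorem IsDirectedTree.sat_reachF (hT : IsDirectedTree V) {x y : ℕ} :
    α.Sat (reachF x y) ↔ Reach (α.elt x) (α.elt y) := by
  simp only [reachF, sat_ex_num, sat_and, sat_maxF, Assignment.num_setNum_self]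
  have key : ∀ n : Dom V .num, numVal n = Nat.card V → ((α.setNum 0 n).Sat
      (.lrec (fun _ : Fin 1 => .elt) (fun _ => x + y + 1) (fun _ => x + y + 2)
        (vars_one_injective _ _) (vars_one_injective _ _) (by simp [vars])
        (fun _ : Fin 1 => 1) (vars_one_injective _ _)
        (edgeF (x + y + 1) (x + y + 2)) (.or (.eq .elt (x + y + 1) y) (.not (zeroF 1)))
        (fun _ => x) (fun _ : Fin 1 => 0)) ↔ Reach (α.elt x) (α.elt y)) := by
    intro n hn
    simp only [Assignment.Sat]
    have hw : (α.setNum 0 n).tuple (fun _ : Fin 1 => .elt) (fun _ => x) =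
        single (α.elt x) := funext fun _ => α.elt_setNum x 0 n
    have hr : tupleVal ((α.setNum 0 n).tuple (fun _ : Fin 1 => .num) (fun _ => 0)) =
        Nat.card V := by
      rw [tupleVal_one, ← hn]
      exact α.num_setNum_self 0 n
    rw [hw, hr, ← hT.recRel_reach_iff (hT.size_le (α.elt x))]
    refine recRel_map (f := single) single_injective
      (fun b b' => ?_) (fun a => ?_) _ _
    · obtain ⟨b, rfl⟩ : ∃ a, single a = b := ⟨b 0, single_apply_zero b⟩
      obtain ⟨b', rfl⟩ : ∃ a, single a = b' := ⟨b' 0, single_apply_zero b'⟩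
      refine (sat_edgeF (((α.setNum 0 n).setElt (x + y + 1) b).setElt (x + y + 2) b')).trans ?_
      rw [Assignment.elt_setElt_self, Assignment.elt_setElt_of_ne _ (by omega),
        Assignment.elt_setElt_self]
      constructor
      · exact fun h => ⟨b, b', rfl, rfl, h⟩
      · rintro ⟨a, a', h, h', hE⟩
        rwa [← single_injective h, ← single_injective h']
    · refine exists_tuple_one_iff (P := fun β => β.Sat _) fun k => ?_
      refine (sat_or (((α.setNum 0 n).setElt (x + y + 1) a).setNum 1 k)).trans ?_
      rw [sat_eq_elt, sat_not, sat_zeroF, Assignment.num_setNum_self, Assignment.elt_setNum,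
        Assignment.elt_setNum, Assignment.elt_setElt_self,
        Assignment.elt_setElt_of_ne _ (by omega), Assignment.elt_setNum]
  constructor
  · rintro ⟨n, hn, h⟩
    exact (key n hn).1 h
  · intro h
    obtain ⟨n, hn⟩ := exists_numVal_eq (V := V) le_rfl
    exact ⟨n, hn, (key n hn).2 h⟩

theorem IsDirectedTree.sat_sizeEqF (hT : IsDirectedTree V) {x y : ℕ} :
    α.Sat (sizeEqF x y) ↔ size (α.elt x) = size (α.elt y) := by
  have := hT.1
  refine sat_sameCountF α (fun n a => ?_) (fun n a => ?_) <;>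
  · rw [hT.sat_reachF, Assignment.elt_setElt_self, Assignment.elt_setElt_of_ne _ (by omega),
      Assignment.elt_setNum]

theorem IsDirectedTree.sat_twinF (hT : IsDirectedTree V) {x y : ℕ} :
    α.Sat (twinF x y) ↔ Twin (α.elt x) (α.elt y) := by
  simp only [twinF, sat_and, sat_not, sat_eq_elt, sat_ex_elt, sat_edgeF, hT.sat_sizeEqF,
    Assignment.elt_setElt_self, α.elt_setElt_of_ne (show x ≠ x + y + 1 by omega),
    α.elt_setElt_of_ne (show y ≠ x + y + 1 by omega)]
  rfl

theorem IsDirectedTree.sat_multEqF (hT : IsDirectedTree V) {x y : ℕ} :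
    α.Sat (multEqF x y) ↔ mult (α.elt x) = mult (α.elt y) := by
  have := hT.1
  refine sat_sameCountF α (fun n a => ?_) (fun n a => ?_) <;>
  · rw [hT.sat_twinF, Assignment.elt_setElt_self, Assignment.elt_setElt_of_ne _ (by omega),
      Assignment.elt_setNum]

end OnTrees

end Formulas

/-! ### The isomorphism formula and the coding of nodes -/

section MainFormula

/-- Kinds are coded by three numbers, each of which is the least or the greatest one. -/
def Kind.code : Kind → Bool × Bool × Bool
  | .iso => (true, true, true)
  | .child => (true, true, false)
  | .pair => (true, false, true)
  | .balance => (true, false, false)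
  | .nonIso => (false, true, true)

theorem Kind.code_injective : Function.Injective Kind.code := by
  rintro (_ | _) (_ | _) <;> simp [Kind.code]

/-- `p` is the greatest number or `0`, according to the given bit. -/
def bitF (b : Bool) (p : ℕ) : GFormula := if b then maxF p else zeroF p

/-- `p, q, r` code the kind `k`. -/
def kindF (k : Kind) (p q r : ℕ) : GFormula :=
  .and (bitF k.code.1 p) (.and (bitF k.code.2.1 q) (bitF k.code.2.2 r))

/-- The disjunction over all kinds. -/
def someKind (φ : Kind → GFormula) : GFormula :=
  .or (φ .iso) (.or (φ .child) (.or (φ .pair) (.or (φ .balance) (φ .nonIso))))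

/-- The pairs of vertices between which there is an edge from kind to kind: from `(0, 1)` to
`(2, 3)`. -/
def edgeCondF : Kind → Kind → GFormula
  | .iso, .child => .and (.eq .elt 3 1) (edgeF 0 2)
  | .child, .pair => .and (.eq .elt 2 0) (.and (edgeF 1 3) (.and (sizeEqF 0 3) (multEqF 0 3)))
  | .pair, .iso => .and (.eq .elt 2 0) (.eq .elt 3 1)
  | .pair, .balance => .and (.eq .elt 2 0) (.eq .elt 3 1)
  | .balance, .iso => .and (.eq .elt 3 1) (twinF 0 2)
  | .balance, .nonIso => .and (.eq .elt 2 0) (twinF 1 3)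
  | .nonIso, .iso => .and (.eq .elt 2 0) (.and (.eq .elt 3 1) (.ex ⟨.elt, 4⟩ (twinF 1 4)))
  | _, _ => .not (.eq .elt 0 0)

/-- The number `6` belongs to the label of the pair `(0, 1)` of the given kind. -/
def labelCondF : Kind → GFormula
  | .iso => .and (countF 2 (edgeF 0 2) 6) (countF 2 (edgeF 1 2) 6)
  | .child => .not (zeroF 6)
  -- A number strictly between 0 and N exists exactly if N ≥ 2.
  | .pair => .ex ⟨.num, 7⟩ (.and (.not (zeroF 7)) (.and (.le 7 6) (.not (.eq .num 7 6))))
  | .balance => countF 2 (twinF 1 2) 6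
  | .nonIso => zeroF 6

/-- The edges of the recursion. -/
def nodeEdgeF : GFormula :=
  someKind fun k => someKind fun k' => .and (kindF k 0 1 2) (.and (kindF k' 3 4 5) (edgeCondF k k'))

/-- The labels of the recursion. -/
def nodeLabelF : GFormula := someKind fun k => .and (kindF k 0 1 2) (labelCondF k)

/-- The sorts of a node of the recursion. -/
def nodeSorts : Fin 5 → Srt := ![.num, .num, .num, .elt, .elt]

theorem vars_injective_of_injective {k : ℕ} {s : Fin k → Srt} {x : Fin k → ℕ}
    (h : ∀ i j, s i = s j → x i = x j → i = j) : Function.Injective (vars s x) := by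
  intro i j hij
  simp only [vars, Var.mk.injEq] at hij
  exact h i j hij.1 hij.2

/-- Equality of the sizes of the subtrees, and isomorphism by limited recursion. -/
def isoF : GFormula :=
  .and (sizeEqF 0 1) (.ex ⟨.num, 7⟩ (.and (maxF 7)
    (.lrec nodeSorts ![0, 1, 2, 0, 1] ![3, 4, 5, 2, 3]
      (vars_injective_of_injective (by intro i j; fin_cases i <;> fin_cases j <;> simp [nodeSorts]))
      (vars_injective_of_injective (by intro i j; fin_cases i <;> fin_cases j <;> simp [nodeSorts]))
      (by intro i j; fin_cases i <;> fin_cases j <;> simp [vars, nodeSorts])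
      (fun _ : Fin 1 => 6) (vars_one_injective _ _) nodeEdgeF nodeLabelF
      -- Three maximal numbers are the code of `iso`. Two maximal digits give the resource |V| +
      -- |V|(|V| + 1), at least |V|².
      ![7, 7, 7, 0, 1] (fun _ : Fin 2 => 7))))

section Free

variable {S : Set Var}

theorem free_someKind_subset {φ : Kind → GFormula} (h : ∀ k, (φ k).free ⊆ S) :
    (someKind φ).free ⊆ S :=
  Formula.free_or_subset (h _) (Formula.free_or_subset (h _) (Formula.free_or_subset (h _)
    (Formula.free_or_subset (h _) (h _))))

theorem free_bitF (b : Bool) (p : ℕ) : (bitF b p).free ⊆ {⟨.num, p⟩} := by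
  cases b
  · exact free_zeroF p
  · exact free_maxF p

theorem free_kindF (k : Kind) (p q r : ℕ) :
    (kindF k p q r).free ⊆ {⟨.num, p⟩, ⟨.num, q⟩, ⟨.num, r⟩} :=
  Formula.free_and_subset ((free_bitF _ _).trans (by simp))
    (Formula.free_and_subset ((free_bitF _ _).trans (by simp)) ((free_bitF _ _).trans (by simp)))

theorem free_edgeCondF (k k' : Kind) :
    (edgeCondF k k').free ⊆ {⟨.elt, 0⟩, ⟨.elt, 1⟩, ⟨.elt, 2⟩, ⟨.elt, 3⟩} := by
  have h : ∀ x y, ({⟨.elt, x⟩, ⟨.elt, y⟩} : Set Var) = (Formula.eq .elt x y : GFormula).free :=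
    fun _ _ => rfl
  have h1 := free_edgeF
  have h2 := free_twinF
  have h3 := free_sizeEqF
  have h4 := free_multEqF
  have h5 : (Formula.ex ⟨.elt, 4⟩ (twinF 1 4)).free ⊆ {⟨.elt, 1⟩} :=
    Formula.free_ex_subset ((free_twinF _ _).trans (by grind))
  cases k <;> cases k' <;> simp only [edgeCondF]
  case iso.child =>
    exact Formula.free_and_subset (by rw [← h]; grind) ((h1 _ _).trans (by grind))
  case child.pair =>
    exact Formula.free_and_subset (by rw [← h]; grind) (Formula.free_and_subset
      ((h1 _ _).trans (by grind)) (Formula.free_and_subset ((h3 _ _).trans (by grind))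
        ((h4 _ _).trans (by grind))))
  case pair.iso => exact Formula.free_and_subset (by rw [← h]; grind) (by rw [← h]; grind)
  case pair.balance => exact Formula.free_and_subset (by rw [← h]; grind) (by rw [← h]; grind)
  case balance.iso =>
    exact Formula.free_and_subset (by rw [← h]; grind) ((h2 _ _).trans (by grind))
  case balance.nonIso =>
    exact Formula.free_and_subset (by rw [← h]; grind) ((h2 _ _).trans (by grind))
  case nonIso.iso =>
    exact Formula.free_and_subset (by rw [← h]; grind)
      (Formula.free_and_subset (by rw [← h]; grind) (h5.trans (by grind)))
  all_goals
    change (Formula.eq .elt 0 0 : GFormula).free ⊆ _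
    rw [← h]
    grind

theorem free_labelCondF (k : Kind) :
    (labelCondF k).free ⊆ {⟨.elt, 0⟩, ⟨.elt, 1⟩, ⟨.num, 6⟩} := by
  cases k
  · exact Formula.free_and_subset (free_countF_subset ((free_edgeF _ _).trans (by grind)) (by simp))
      (free_countF_subset ((free_edgeF _ _).trans (by grind)) (by simp))
  · exact (free_zeroF 6).trans (by simp)
  · refine Formula.free_ex_subset (Formula.free_and_subset ((free_zeroF 7).trans (by simp))
      (Formula.free_and_subset ?_ ?_)) <;>
    · intro x hx
      rcases hx with rfl | rfl <;> simp
  · exact free_countF_subset ((free_twinF _ _).trans (by grind)) (by simp)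
  · exact (free_zeroF 6).trans (by simp)

theorem free_isoF : isoF.free ⊆ {varX, varY} := by
  refine Formula.free_and_subset (free_sizeEqF 0 1) (Formula.free_ex_subset
    (Formula.free_and_subset ((free_maxF 7).trans (by simp)) ?_))
  rintro v (((⟨hv, hv'⟩ | ⟨hv, hv'⟩) | ⟨i, rfl⟩) | ⟨i, rfl⟩)
  · refine (hv' ?_).elim
    have hE : nodeEdgeF.free ⊆ {⟨.num, 0⟩, ⟨.num, 1⟩, ⟨.num, 2⟩, ⟨.num, 3⟩, ⟨.num, 4⟩, ⟨.num, 5⟩,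
        ⟨.elt, 0⟩, ⟨.elt, 1⟩, ⟨.elt, 2⟩, ⟨.elt, 3⟩} :=
      free_someKind_subset fun k => free_someKind_subset fun k' => Formula.free_and_subset
        ((free_kindF _ _ _ _).trans (by grind)) (Formula.free_and_subset
          ((free_kindF _ _ _ _).trans (by grind)) ((free_edgeCondF _ _).trans (by grind)))
    rcases hE hv with rfl | rfl | rfl | rfl | rfl | rfl | rfl | rfl | rfl | rfl
    exacts [.inl ⟨0, rfl⟩, .inl ⟨1, rfl⟩, .inl ⟨2, rfl⟩, .inr ⟨0, rfl⟩, .inr ⟨1, rfl⟩,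
      .inr ⟨2, rfl⟩, .inl ⟨3, rfl⟩, .inl ⟨4, rfl⟩, .inr ⟨3, rfl⟩, .inr ⟨4, rfl⟩]
  · refine (hv' ?_).elim
    have hC : nodeLabelF.free ⊆ {⟨.num, 0⟩, ⟨.num, 1⟩, ⟨.num, 2⟩, ⟨.elt, 0⟩, ⟨.elt, 1⟩,
        ⟨.num, 6⟩} :=
      free_someKind_subset fun k => Formula.free_and_subset ((free_kindF _ _ _ _).trans (by grind))
        ((free_labelCondF _).trans (by grind))
    rcases hC hv with rfl | rfl | rfl | rfl | rfl | rfl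
    exacts [.inl ⟨0, rfl⟩, .inl ⟨1, rfl⟩, .inl ⟨2, rfl⟩, .inl ⟨3, rfl⟩, .inl ⟨4, rfl⟩,
      .inr ⟨0, rfl⟩]
  · fin_cases i <;> simp [vars, nodeSorts, varX, varY]
  · simp [numVars, vars]

end Free

variable {V : Type u}

/-- The number that stands for a bit. -/
noncomputable def bitVal (V : Type u) (b : Bool) : Dom V .num := ⟨if b then Fin.last _ else 0⟩

theorem numVal_bitVal (b : Bool) : numVal (bitVal V b) = if b then Nat.card V else 0 := by
  cases b <;> rfl

/-- In a non-empty finite structure 0 and |V| differ, so even a single vertex leaves two numbers to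
code with. -/
theorem bitVal_injective [Finite V] [Nonempty V] : Function.Injective (bitVal V) := by
  have : 0 < Nat.card V := Nat.card_pos
  intro b b' h
  have := congrArg numVal h
  rw [numVal_bitVal, numVal_bitVal] at this
  cases b <;> cases b' <;> simp at this ⊢ <;> omega

/-- The tuple that codes a node of the recursion. -/
noncomputable def encode (x : Kind × V × V) : TupleDom V nodeSorts := fun
  | 0 => bitVal V x.1.code.1
  | 1 => bitVal V x.1.code.2.1
  | 2 => bitVal V x.1.code.2.2
  | 3 => x.2.1
  | 4 => x.2.2

/-- The first vertex of a tuple. -/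
def fstVertex (a : TupleDom V nodeSorts) : V := a 3

/-- The second vertex of a tuple. -/
def sndVertex (a : TupleDom V nodeSorts) : V := a 4

/-- The tuple codes a node of the given kind. -/
def HasKind (k : Kind) (a : TupleDom V nodeSorts) : Prop :=
  a 0 = bitVal V k.code.1 ∧ a 1 = bitVal V k.code.2.1 ∧ a 2 = bitVal V k.code.2.2

theorem encode_eq_iff {x : Kind × V × V} {a : TupleDom V nodeSorts} :
    encode x = a ↔ HasKind x.1 a ∧ x.2.1 = fstVertex a ∧ x.2.2 = sndVertex a := by
  constructor
  · rintro rfl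
    exact ⟨⟨rfl, rfl, rfl⟩, rfl, rfl⟩
  · rintro ⟨⟨h0, h1, h2⟩, h3, h4⟩
    funext i
    fin_cases i
    exacts [h0.symm, h1.symm, h2.symm, h3, h4]

theorem HasKind.unique [Finite V] [Nonempty V] {k k' : Kind} {a : TupleDom V nodeSorts}
    (h : HasKind k a) (h' : HasKind k' a) : k = k' := by
  refine Kind.code_injective (Prod.ext ?_ (Prod.ext ?_ ?_))
  · exact bitVal_injective (h.1.symm.trans h'.1)
  · exact bitVal_injective (h.2.1.symm.trans h'.2.1)
  · exact bitVal_injective (h.2.2.symm.trans h'.2.2)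

theorem encode_injective [Finite V] [Nonempty V] : Function.Injective (encode (V := V)) := by
  intro x y h
  obtain ⟨h1, h2, h3⟩ := encode_eq_iff.1 h
  exact Prod.ext (h1.unique (encode_eq_iff.1 rfl).1) (Prod.ext h2 h3)

variable [digraphVocabulary.Structure V] {α : Assignment V}

@[simp]
theorem sat_someKind {φ : Kind → GFormula} : α.Sat (someKind φ) ↔ ∃ k, α.Sat (φ k) := by
  simp only [someKind, sat_or]
  constructor
  · rintro (h | h | h | h | h)
    exacts [⟨_, h⟩, ⟨_, h⟩, ⟨_, h⟩, ⟨_, h⟩, ⟨_, h⟩]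
  · rintro ⟨_ | _, h⟩ <;> simp [h]

theorem sat_bitF {b : Bool} {p : ℕ} : α.Sat (bitF b p) ↔ α ⟨.num, p⟩ = bitVal V b := by
  rw [← numVal_injective.eq_iff, numVal_bitVal]
  cases b
  · exact sat_zeroF α
  · exact sat_maxF α

theorem sat_kindF {k : Kind} {p q r : ℕ} : α.Sat (kindF k p q r) ↔
    α ⟨.num, p⟩ = bitVal V k.code.1 ∧ α ⟨.num, q⟩ = bitVal V k.code.2.1 ∧
      α ⟨.num, r⟩ = bitVal V k.code.2.2 := by
  simp only [kindF, sat_and, sat_bitF]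

theorem IsDirectedTree.sat_edgeCondF (hT : IsDirectedTree V) {k k' : Kind} :
    α.Sat (edgeCondF k k') ↔
      NodeEdge (k, α.elt 0, α.elt 1) (k', α.elt 2, α.elt 3) := by
  cases k <;> cases k' <;>
    simp [edgeCondF, NodeEdge, hT.sat_sizeEqF, hT.sat_multEqF, hT.sat_twinF,
      Assignment.elt_setElt_of_ne]

theorem IsDirectedTree.sat_labelCondF (hT : IsDirectedTree V) {k : Kind} :
    (α.num 6 ≤ Nat.card V ∧ α.Sat (labelCondF k)) ↔
      α.num 6 ∈ nodeLabel (k, α.elt 0, α.elt 1) := by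
  have hle : α.num 6 ≤ Nat.card V := numVal_le _
  cases k
  · rw [and_iff_right hle, labelCondF, sat_and,
      sat_countF (P := fun a => Edge V (α.elt 0) a) α
        (fun a => by simp [Assignment.elt_setElt_of_ne]),
      sat_countF (P := fun a => Edge V (α.elt 1) a) α
        (fun a => by simp [Assignment.elt_setElt_of_ne])]
    exact and_congr eq_comm eq_comm
  · rw [labelCondF, sat_not, sat_zeroF, ← ne_eq, ← Nat.pos_iff_ne_zero]
    rfl
  · rw [labelCondF, sat_ex_num]
    refine and_congr_right fun _ => ?_
    simp only [sat_and, sat_not, sat_zeroF, sat_le, sat_eq_num, Assignment.num_setNum_self,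
      α.num_setNum_of_ne (show 6 ≠ 7 by decide)]
    constructor
    · rintro ⟨n, h⟩
      omega
    · intro h
      obtain ⟨n, hn⟩ := exists_numVal_eq (V := V) (k := 1) (by omega)
      exact ⟨n, by omega⟩
  · rw [and_iff_right hle, labelCondF, sat_countF (P := fun a => Twin (α.elt 1) a) α
      (fun a => by simp [hT.sat_twinF, Assignment.elt_setElt_of_ne])]
    exact eq_comm
  · rw [and_iff_right hle, labelCondF, sat_zeroF]
    rfl

/-- Equality of sizes is necessary for isomorphism, and it is the hypothesis under which the
resource bound of `nodeRel_iso_iff` applies. -/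
theorem IsDirectedTree.sat_isoF (hT : IsDirectedTree V) :
    α.Sat isoF ↔ SubtreeIso (α.elt 0) (α.elt 1) := by
  have := hT.1
  have : Nonempty V := ⟨α.elt 0⟩
  have hu := vars_injective_of_injective (s := nodeSorts) (x := ![0, 1, 2, 0, 1])
    (by intro i j; fin_cases i <;> fin_cases j <;> simp [nodeSorts])
  have hv := vars_injective_of_injective (s := nodeSorts) (x := ![3, 4, 5, 2, 3])
    (by intro i j; fin_cases i <;> fin_cases j <;> simp [nodeSorts])
  have huv : ∀ i j, vars nodeSorts ![0, 1, 2, 0, 1] i ≠ vars nodeSorts ![3, 4, 5, 2, 3] j := by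
    intro i j; fin_cases i <;> fin_cases j <;> simp [vars, nodeSorts]
  have key : size (α.elt 0) = size (α.elt 1) → ∀ n : Dom V .num, numVal n = Nat.card V →
      ((α.setNum 7 n).Sat (.lrec nodeSorts ![0, 1, 2, 0, 1] ![3, 4, 5, 2, 3] hu hv huv
        (fun _ : Fin 1 => 6) (vars_one_injective _ _) nodeEdgeF nodeLabelF
        ![7, 7, 7, 0, 1] (fun _ : Fin 2 => 7)) ↔ SubtreeIso (α.elt 0) (α.elt 1)) := by
    intro hs n hn
    simp only [Assignment.Sat]
    set γ := α.setNum 7 n with hγ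
    have h7 : γ ⟨.num, 7⟩ = bitVal V true := by
      apply numVal_injective
      rw [numVal_bitVal, if_pos rfl, ← hn]
      exact α.num_setNum_self 7 n
    have hw : γ.tuple nodeSorts ![7, 7, 7, 0, 1] = encode (.iso, α.elt 0, α.elt 1) := by
      symm
      rw [encode_eq_iff]
      exact ⟨⟨h7, h7, h7⟩, (α.elt_setNum 0 7 n).symm, (α.elt_setNum 1 7 n).symm⟩
    have hr : size (α.elt 0) ^ 2 ≤
        tupleVal (γ.tuple (fun _ : Fin 2 => .num) (fun _ => 7)) := by
      have h7' : numVal (γ ⟨.num, 7⟩) = Nat.card V := by rw [h7, numVal_bitVal, if_pos rfl]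
      have e : tupleVal (γ.tuple (fun _ : Fin 2 => .num) (fun _ => 7)) =
          Nat.card V + Nat.card V * (Nat.card V + 1) := by
        rw [tupleVal, Fin.sum_univ_two]
        change numVal (γ ⟨.num, 7⟩) * _ + numVal (γ ⟨.num, 7⟩) * _ = _
        rw [h7']
        simp
      have := Nat.pow_le_pow_left (hT.size_le (α.elt 0)) 2
      rw [e]
      nlinarith
    rw [hw, ← hT.nodeRel_iso_iff hs hr]
    -- Tuples that code no node satisfy no kind formula and are therefore isolated.
    refine recRel_map encode_injective (fun a b => ?_) (fun x => ?_) _ _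
    · set β := (γ.update nodeSorts ![0, 1, 2, 0, 1] a).update nodeSorts ![3, 4, 5, 2, 3] b with hβ
      have hb : ∀ i, β (vars nodeSorts ![3, 4, 5, 2, 3] i) = b i := fun i =>
        Assignment.update_of_mem _ _ _ hv _ i
      have ha : ∀ i, β (vars nodeSorts ![0, 1, 2, 0, 1] i) = a i := fun i =>
        (Assignment.update_of_notMem _ _ _ _ _ fun j => (huv i j).symm).trans
          (Assignment.update_of_mem _ _ _ hu _ i)
      have hsat : ∀ k k', β.Sat (.and (kindF k 0 1 2) (.and (kindF k' 3 4 5) (edgeCondF k k'))) ↔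
          HasKind k a ∧ HasKind k' b ∧
            NodeEdge (k, fstVertex a, sndVertex a) (k', fstVertex b, sndVertex b) := by
        intro k k'
        rw [sat_and, sat_and, sat_kindF, sat_kindF, hT.sat_edgeCondF]
        rw [show β.elt 0 = fstVertex a from ha 3, show β.elt 1 = sndVertex a from ha 4,
          show β.elt 2 = fstVertex b from hb 3, show β.elt 3 = sndVertex b from hb 4,
          show β ⟨.num, 0⟩ = a 0 from ha 0, show β ⟨.num, 1⟩ = a 1 from ha 1,
          show β ⟨.num, 2⟩ = a 2 from ha 2, show β ⟨.num, 3⟩ = b 0 from hb 0,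
          show β ⟨.num, 4⟩ = b 1 from hb 1, show β ⟨.num, 5⟩ = b 2 from hb 2]
        rfl
      simp only [nodeEdgeF, sat_someKind, hsat, encode_eq_iff]
      constructor
      · rintro ⟨k, k', h, h', hE⟩
        exact ⟨_, _, ⟨h, rfl, rfl⟩, ⟨h', rfl, rfl⟩, hE⟩
      · rintro ⟨⟨k, x, y⟩, ⟨k', x', y'⟩, ⟨h, rfl, rfl⟩, ⟨h', rfl, rfl⟩, hE⟩
        exact ⟨k, k', h, h', hE⟩
    · have hx : HasKind x.1 (encode x) := (encode_eq_iff.1 rfl).1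
      set β := γ.update nodeSorts ![0, 1, 2, 0, 1] (encode x) with hβ
      have ha : ∀ i, β (vars nodeSorts ![0, 1, 2, 0, 1] i) = encode x i := fun i =>
        Assignment.update_of_mem _ _ _ hu _ i
      have hsat : ∀ n, (β.setNum 6 n).Sat nodeLabelF ↔
          ∃ k, HasKind k (encode x) ∧ (β.setNum 6 n).Sat (labelCondF k) := by
        intro n
        have hn : ∀ p, p ≠ 6 → (β.setNum 6 n) ⟨.num, p⟩ = β ⟨.num, p⟩ := fun p hp =>
          numVal_injective (β.num_setNum_of_ne hp n)
        simp only [nodeLabelF, sat_someKind, sat_and, sat_kindF]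
        rw [hn 0 (by decide), hn 1 (by decide), hn 2 (by decide),
          show β ⟨.num, 0⟩ = _ from ha 0, show β ⟨.num, 1⟩ = _ from ha 1,
          show β ⟨.num, 2⟩ = _ from ha 2]
        rfl
      have hlabel : ∀ n, (β.setNum 6 n).Sat nodeLabelF ↔ numVal n ∈ nodeLabel x := by
        intro n
        have h0 : (β.setNum 6 n).elt 0 = x.2.1 := (β.elt_setNum 0 6 n).trans (ha 3)
        have h1 : (β.setNum 6 n).elt 1 = x.2.2 := (β.elt_setNum 1 6 n).trans (ha 4)
        have h6 := β.num_setNum_self 6 n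
        have h := hT.sat_labelCondF (α := β.setNum 6 n) (k := x.1)
        rw [h0, h1, h6, and_iff_right (numVal_le n)] at h
        rw [hsat, ← h]
        constructor
        · rintro ⟨k, hk, h'⟩
          rwa [← hk.unique hx]
        · exact fun h' => ⟨_, hx, h'⟩
      rw [exists_tuple_one_iff (P := fun β => β.Sat nodeLabelF) (Q := fun N => N ∈ nodeLabel x)
        hlabel]
      ext N
      -- Every label lies below |V|, so restricting to the values of one number variable loses
      -- nothing.
      refine and_iff_right_of_imp fun hN => ?_
      have hle : ∀ s : Set V, s.ncard ≤ Nat.card V := fun s => by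
        rw [← Set.ncard_univ]
        exact Set.ncard_le_ncard (Set.subset_univ _)
      obtain ⟨_ | _, v, w⟩ := x
      · exact hN.1.trans_le (hle _)
      · exact hN.1
      · exact hN.1
      · exact hN.trans_le (hle _)
      · exact hN.trans_le (Nat.zero_le _)
  rw [isoF, sat_and, hT.sat_sizeEqF, sat_ex_num]
  constructor
  · rintro ⟨hs, n, h⟩
    rw [sat_and, sat_maxF, Assignment.num_setNum_self] at h
    exact (key hs n h.1).1 h.2
  · intro h
    obtain ⟨n, hn⟩ := exists_numVal_eq (V := V) le_rfl
    refine ⟨h.size_eq, n, ?_⟩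
    rw [sat_and, sat_maxF, Assignment.num_setNum_self]
    exact ⟨hn, (key h.size_eq n hn).2 h⟩

end MainFormula

end LREC

theorem mainTheorem6 :
    ∃ φ : LREC.Formula LREC.digraphVocabulary,
      φ.free ⊆ {LREC.varX, LREC.varY} ∧
      ∀ (T : Type*) [LREC.digraphVocabulary.Structure T], LREC.IsDirectedTree T →
        ∀ v w : T, LREC.Models T φ v w ↔ LREC.SubtreeIso v w := by
  refine ⟨LREC.isoF, LREC.free_isoF, fun T _ hT v w => ?_⟩
  constructor
  · intro h
    -- `Models` quantifies over all assignments, so one with the prescribed values must be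
    -- exhibited; the other values are arbitrary.
    let α₀ : LREC.Assignment T := fun x => match x with
      | ⟨.elt, 0⟩ => v
      | ⟨.elt, _⟩ => w
      | ⟨.num, _⟩ => LREC.bitVal T false
    exact hT.sat_isoF.1 (h α₀ rfl rfl)
  · rintro h α rfl rfl
    exact hT.sat_isoF.2 h
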